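/- **Market.** Stages are $t=0,\dots,T$, periods have length $\delta>0$. Electricity and carbon prices satisfy $$P_{t+1}=G(P_t,\varepsilon^P_t),\qquad X_{t+1}=X_t\exp\bigl(\kappa(f(u_1(t),u_2(t))-\log X_t)\delta+\sigma\varepsilon^X_t\bigr),\qquad f(u_1,u_2)=\log(\bar X+g_1u_1+g_2u_2),$$ where $G$ is measurable, $\varepsilon^X_t=\rho\varepsilon^P_t+\sqrt{1-\rho^2}\,\varepsilon^\perp_t$ with $\rho\in[-1,1]$, the $\varepsilon^P_t,\varepsilon^\perp_t$ are i.i.d. standard Gaussian, $\bar X+g_1u_1+g_2u_2>0$ for all $u\in\{0,1\}^2$, and $\mathbb E[P_t^-\mid P_0=p]<\infty$ for all $t,p$. The regimes $u_i(t)\in\{0,1\}$ of players $i=1,2$ may be changed at each stage $t<T$. Producing earns player $i$ the truncated rate $\pi_i(p,x)=\min(L,\,a_ip-b_ix-c_i)$ with $L>0$, $a_i\ge 0$. Switching costs satisfy $K_{i,j,j}=0$ and $K_{i,j,l}\le K_{i,j,k}+K_{i,k,l}$. **Cascade of stopping games.** A correlated equilibrium point (CEP) of a $2\times2$ game $H=(H_i^{jk})$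 is a probability $\gamma$ on $\{0,1\}^2$ such that no player, told only her own component of the profile drawn from $\gamma$, gains in expectation by changing it. Fix a correlation law $\Gamma$: for every stage $t$ a jointly measurable map $(p,x,H)\mapsto\Gamma(t,p,x,H)$ whose value is a CEP of $H$. Actions are $1$ (switch) and $0$ (do not). Define $\hat J_i^{n,m}(t,p,x,\zeta)$, where $\zeta\in\{0,1\}^2$ are the current regimes and $n,m$ the numbers of switches left, by $\hat J_i^{n,m}(T,\cdot)=0$ and, for $t<T$ and $n,m\ge1$, $\hat J_i^{n,m}(t,p,x,\zeta)=\sum_{j,k}\Gamma_{jk}(t,p,x,H)\,H_i^{jk}$, where $H=H^{n,m}(t,p,x,\zeta)$ is $$\begin{aligned}H_i^{00}&=\pi_i(p,x)\zeta_i\delta+\mathbb E^{\zeta}\bigl[\hat J_i^{n,m}(t+1,P_{t+1},X_{t+1},\zeta)\mid P_t=p,X_t=x\bigr],\\ H_i^{01}&=\hat J_i^{n,m-1}(t,p,x,\zeta_1,1-\zeta_2)-1_{\{i=2\}}K_{2,\zeta_2,1-\zeta_2},\\ H_i^{10}&=\hat J_i^{n-1,m}(t,p,x,1-\zeta_1,\zeta_2)-1_{\{i=1\}}K_{1,\zeta_1,1-\zeta_1},\\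 H_i^{11}&=\hat J_i^{n-1,m-1}(t,p,x,1-\zeta_1,1-\zeta_2)-K_{i,\zeta_i,1-\zeta_i}.\end{aligned}$$ If $n=m=0$, then $\hat J_i^{0,0}=H_i^{00}$ (with $n=m=0$ in the formula above). If $n\ge1$, $m=0$, then $\hat J_1^{n,0}$ is the value $\max(H^{00}_1,H^{10}_1)$ of player 1's single-player problem. Fix a measurable, possibly randomized, Markov control attaining this maximum in every state; player 1 uses it and $\hat J_2^{n,0}$ is the resulting payoff of player 2. The case $n=0$, $m\ge1$ is symmetric. **The game.** In the $(n,m)$-restricted game, player 1 may switch at most $n$ times and player 2 at most $m$ times in total. Each stage $t<T$ is played in rounds. In a round, a third party looks at the prices, the latest regimes $\zeta$ and the numbers $n',m'$ of switches left, draws a pair of signals from the lottery $\gamma^{n,m}$ given by $\Gamma(t,P_t,X_t,H^{n',m'}(t,P_t,X_t,\zeta))$ (for $n'=0$ or $m'=0$: the fixed single-player control, the other player being told $0$), and tells each player her own signal; then both players act simultaneously. If somebody switches, another round follows at the same stage; if nobody does, or if no switches are left, the stage ends and the prices move on with the regimes $u(t)$ then in force. Let $u_i^{n,m}$ be the control of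 player $i$ that always obeys her signals. A control $u_1\in\mathcal U_1^n$ of player 1 makes a.s. at most $n$ switches, and its actions are adapted to a filtration that contains all past events (prices, signals, actions), private randomization independent of the future randomness, and her current signal; $\mathcal U_2^m$ is analogous. For a start at stage $s\le T$ with $P_s=p$, $X_s=x>0$ and regimes $\zeta$ before stage $s$, the expected profit is $$V_i(s,p,x,\zeta;u_1,u_2)=\mathbb E\Bigl[\sum_{t=s}^{T-1}\bigl\{\pi_i(P_t,X_t)u_i(t)\delta-C_i(t)\bigr\}\Bigr],$$ where $C_i(t)$ is the sum of the costs of the single switches made by player $i$ at stage $t$. Let $\bar V_i$ be the same quantity with $C_i(t)$ replaced by the cost $K_{i,u_i(t-),u_i(t)}$ of the net change of regime at stage $t$. **Theorem.** For all $n,m\ge0$ and all $(s,p,x,\zeta)$ with $s\le T$ and $x>0$, we have $u_1^{n,m}\in\mathcal U_1^n$ and $u_2^{n,m}\in\mathcal U_2^m$, the payoffs below are integrable, and the pair $(u_1^{n,m},u_2^{n,m})$ is a correlated equilibrium: $$V_1(s,\cdot;u_1^{n,m},u_2^{n,m})\ge V_1(s,\cdot;u_1,u_2^{n,m})\quad\forall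 u_1\in\mathcal U_1^n,\qquad V_2(s,\cdot;u_1^{n,m},u_2^{n,m})\ge V_2(s,\cdot;u_1^{n,m},u_2)\quad\forall u_2\in\mathcal U_2^m.$$ The same inequalities hold with $\bar V_i$ in place of $V_i$ for all deviations $u_1\in\mathcal U_1^n$ (resp. $u_2\in\mathcal U_2^m$) that switch at most once per stage. -/

import Mathlib

open MeasureTheory ProbabilityTheory

open scoped ENNReal

noncomputable section

namespace EmissionGame

/-- A pair of binary data, one per player (player 1 is index `0`, player 2 is index `1`).
As a production regime, `true` means "on"; as an action, `true` means "switch". -/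
abbrev Profile := Fin 2 → Bool

/-- The numerical value `1` ("on") or `0` ("off") of a production regime. -/
def level (z : Bool) : ℝ := if z then 1 else 0

/-- The action profile in which nobody switches. -/
def pass : Profile := fun _ => false

/-- The production regimes after the players in `a` have switched. -/
def toggle (ζ a : Profile) : Profile := fun i => xor (ζ i) (a i)

/-- The law of the pair `(ε^P, ε^⊥)` of independent standard Gaussian innovations. -/
def noiseLaw : Measure (ℝ × ℝ) := (gaussianReal 0 1).prod (gaussianReal 0 1)

/-- The expected negative part of `P_t` for the chain `P_{t+1} = G(P_t, ε_t)`, `P_0 = p`,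
with independent standard Gaussian innovations. -/
def priceShortfall (G : ℝ → ℝ → ℝ) : ℕ → ℝ → ℝ≥0∞
  | 0, p => ENNReal.ofReal (-p)
  | t + 1, p => ∫⁻ e, priceShortfall G t (G p e) ∂(gaussianReal 0 1)

/-! ### The market -/

/-- The data of the duopoly in the electricity and carbon-allowance markets. -/
structure Market where
  /-- the horizon (number of stages) -/
  T : ℕ
  /-- the length of one period -/
  dt : ℝ
  dt_pos : 0 < dt
  /-- the electricity price follows `P_{t+1} = G(P_t, ε^P_t)` -/
  G : ℝ → ℝ → ℝ
  measurable_G : Measurable (Function.uncurry G)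
  shortfall_finite : ∀ t p, priceShortfall G t p < ⊤
  /-- mean-reversion speed of the allowance price -/
  κ : ℝ
  /-- volatility of the allowance price -/
  σ : ℝ
  /-- correlation of the innovations of the two prices -/
  ρ : ℝ
  ρ_mem : ρ ∈ Set.Icc (-1 : ℝ) 1
  /-- base level of the allowance price -/
  Xbar : ℝ
  /-- price impact of the two producers -/
  g : Fin 2 → ℝ
  impact_pos : ∀ u : Profile, 0 < Xbar + ∑ i, g i * level (u i)
  /-- electricity produced in one period -/
  a : Fin 2 → ℝ
  a_nonneg : ∀ i, 0 ≤ a i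
  /-- allowances needed in one period -/
  b : Fin 2 → ℝ
  /-- fixed production costs -/
  c : Fin 2 → ℝ
  /-- the level at which profits are truncated from above -/
  cap : ℝ
  cap_pos : 0 < cap
  /-- switching costs -/
  K : Fin 2 → Bool → Bool → ℝ
  K_self : ∀ i j, K i j j = 0
  K_triangle : ∀ i j k l, K i j l ≤ K i j k + K i k l

/-- The mean-reversion level `log (Xbar + g₁ u₁ + g₂ u₂)` of the logarithmic allowance price. -/
def Market.f (M : Market) (u : Profile) : ℝ :=
  Real.log (M.Xbar + ∑ i, M.g i * level (u i))

/-- The allowance price one period later when the regimes are `u` and the innovations are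
`e = (ε^P, ε^⊥)`. -/
def Market.nextX (M : Market) (u : Profile) (x : ℝ) (e : ℝ × ℝ) : ℝ :=
  x * Real.exp (M.κ * (M.f u - Real.log x) * M.dt
    + M.σ * (M.ρ * e.1 + √(1 - M.ρ ^ 2) * e.2))

/-- The profit rate of player `i` when producing, truncated from above. -/
def Market.profit (M : Market) (i : Fin 2) (p x : ℝ) : ℝ :=
  min M.cap (M.a i * p - M.b i * x - M.c i)

/-- The switching cost that player `i` incurs under an action profile: a switch of her own costs
`K_{i, ζ_i, 1 - ζ_i}`. -/
def Market.switchCost (M : Market) (i : Fin 2) (ζ act : Profile) : ℝ :=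
  if act i then M.K i (ζ i) (!ζ i) else 0

/-- The payoff of player `i` when no (further) switch is made at the present stage, the prices
are `p`, `x`, the regimes are `ζ`, and `w` is her value at the next stage as a function of the
prices: current profit plus `E^ζ[w(P_{t+1}, X_{t+1}) | P_t = p, X_t = x]`. -/
def Market.hold (M : Market) (i : Fin 2) (ζ : Profile) (p x : ℝ) (w : ℝ → ℝ → ℝ) : ℝ :=
  M.profit i p x * level (ζ i) * M.dt + ∫ e, w (M.G p e.1) (M.nextX ζ x e) ∂noiseLaw

/-! ### Correlated equilibria of one-shot two-by-two games -/

/-- A two-by-two game: the payoff of each player for each action profile. -/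
abbrev Game := Profile → Fin 2 → ℝ

/-- A lottery over action profiles (a point of the simplex `Δ₄` when it is a probability). -/
abbrev Lottery := Profile → ℝ

/-- `γ` is a correlated equilibrium point of `H`: a probability distribution on action profiles
such that no player `i`, being told only her own component of the drawn profile, gains by
replacing the action `j` recommended to her by `d j`. -/
def IsCEP (H : Game) (γ : Lottery) : Prop :=
  (∀ a, 0 ≤ γ a) ∧ ∑ a, γ a = 1 ∧
    ∀ (i : Fin 2) (d : Bool → Bool),
      ∑ a, γ a * H (Function.update a i (d (a i))) i ≤ ∑ a, γ a * H a i

/-- A correlation law: a measurable selection of a correlated equilibrium point of every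
two-by-two game, which may depend on the stage and on the current prices. -/
structure CorrelationLaw where
  select : ℕ → ℝ × ℝ → Game → Lottery
  measurable_select : ∀ t, Measurable (fun y : (ℝ × ℝ) × Game => select t y.1 y.2)
  isCEP : ∀ t y H, IsCEP H (select t y H)

/-! ### The single-player problems -/

/-- The action profile in which player `i` alone switches. -/
def only (i : Fin 2) : Profile := fun j => decide (j = i)

/-- `soloValue M i h n ζ p x` is the optimal value of player `i` when `h` stages remain, she may
still switch `n` times, and the other player never switches again. -/
def soloValue (M : Market) (i : Fin 2) : ℕ → ℕ → Profile → ℝ → ℝ → ℝ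
  | 0, _ => fun _ _ _ => 0
  | h + 1, 0 => fun ζ p x => M.hold i ζ p x (soloValue M i h 0 ζ)
  | h + 1, n + 1 => fun ζ p x =>
      max (M.hold i ζ p x (soloValue M i h (n + 1) ζ))
        (soloValue M i (h + 1) n (toggle ζ (only i)) p x - M.K i (ζ i) (!ζ i))
termination_by h n => h + n

/-- A (possibly randomized) optimal Markov control for the single-player problems:
`prob i n t ζ (p, x)` is the probability with which player `i` switches when she has `n` switches
left and the other player has none. -/
structure SoloControl (M : Market) where
  prob : Fin 2 → ℕ → ℕ → Profile → ℝ × ℝ → ℝ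
  measurable_prob : ∀ i n t ζ, Measurable (prob i n t ζ)
  prob_mem : ∀ i n t ζ y, prob i n t ζ y ∈ Set.Icc (0 : ℝ) 1
  optimal : ∀ (i : Fin 2) (n t : ℕ) (ζ : Profile) (p x : ℝ), t < M.T →
    (1 - prob i (n + 1) t ζ (p, x)) * M.hold i ζ p x (soloValue M i (M.T - (t + 1)) (n + 1) ζ)
      + prob i (n + 1) t ζ (p, x) *
        (soloValue M i (M.T - t) n (toggle ζ (only i)) p x - M.K i (ζ i) (!ζ i))
      = soloValue M i (M.T - t) (n + 1) ζ p x

/-! ### The cascade of stopping games -/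

/-- The values of both players as a function of the regimes and the prices. -/
abbrev Value := Profile → ℝ → ℝ → Fin 2 → ℝ

/-- The one-shot game played in regimes `ζ` at prices `p`, `x`. If both continue, the current
profit is earned and the same stopping game goes on at the next stage with value `w₀₀`; otherwise
the stopping game ends and is replaced, at the same stage, by one with value `w₁₀`, `w₀₁` or `w₁₁`
(player 1, player 2 or both have switched), the switching costs being deducted. -/
def roundGame (M : Market) (w₀₀ w₀₁ w₁₀ w₁₁ : Value) (ζ : Profile) (p x : ℝ) : Game :=
  fun act i =>
    match act 0, act 1 with
    | false, false => M.hold i ζ p x (fun p' x' => w₀₀ ζ p' x' i)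
    | false, true => w₀₁ (toggle ζ act) p x i - M.switchCost i ζ act
    | true, false => w₁₀ (toggle ζ act) p x i - M.switchCost i ζ act
    | true, true => w₁₁ (toggle ζ act) p x i - M.switchCost i ζ act

/-- `gameValue M Γ β h n m ζ p x i` is the value `Ĵ_i^{n,m}(T - h, p, x, ζ)` for player `i` of the
stopping game played when `h` stages remain and the players may still switch `n` and `m` times. -/
def gameValue (M : Market) (Γ : CorrelationLaw) (β : SoloControl M) : ℕ → ℕ → ℕ → Value
  | 0, _, _ => fun _ _ _ _ => 0
  | h + 1, 0, 0 => fun ζ p x i => M.hold i ζ p x (fun p' x' => gameValue M Γ β h 0 0 ζ p' x' i)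
  | h + 1, n + 1, 0 => fun ζ p x i =>
      if i = 0 then soloValue M 0 (h + 1) (n + 1) ζ p x
      else
        (1 - β.prob 0 (n + 1) (M.T - (h + 1)) ζ (p, x)) *
            M.hold i ζ p x (fun p' x' => gameValue M Γ β h (n + 1) 0 ζ p' x' i)
          + β.prob 0 (n + 1) (M.T - (h + 1)) ζ (p, x) *
            gameValue M Γ β (h + 1) n 0 (toggle ζ (only 0)) p x i
  | h + 1, 0, m + 1 => fun ζ p x i =>
      if i = 1 then soloValue M 1 (h + 1) (m + 1) ζ p x
      else
        (1 - β.prob 1 (m + 1) (M.T - (h + 1)) ζ (p, x)) *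
            M.hold i ζ p x (fun p' x' => gameValue M Γ β h 0 (m + 1) ζ p' x' i)
          + β.prob 1 (m + 1) (M.T - (h + 1)) ζ (p, x) *
            gameValue M Γ β (h + 1) 0 m (toggle ζ (only 1)) p x i
  | h + 1, n + 1, m + 1 => fun ζ p x i =>
      let H := roundGame M (gameValue M Γ β h (n + 1) (m + 1)) (gameValue M Γ β (h + 1) (n + 1) m)
        (gameValue M Γ β (h + 1) n (m + 1)) (gameValue M Γ β (h + 1) n m) ζ p x
      ∑ act, Γ.select (M.T - (h + 1)) (p, x) H act * H act i
termination_by h n m => h + n + m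

/-- The communication device: the lottery over action profiles used at stage `t < T` when the
players have `n` and `m` switches left, the regimes are `ζ` and the prices are `p`, `x`. -/
def device (M : Market) (Γ : CorrelationLaw) (β : SoloControl M) (t : ℕ) :
    ℕ → ℕ → Profile → ℝ → ℝ → Lottery
  | 0, 0 => fun _ _ _ act => if act = pass then 1 else 0
  | n + 1, 0 => fun ζ p x act =>
      if act = only 0 then β.prob 0 (n + 1) t ζ (p, x)
      else if act = pass then 1 - β.prob 0 (n + 1) t ζ (p, x) else 0
  | 0, m + 1 => fun ζ p x act =>
      if act = only 1 then β.prob 1 (m + 1) t ζ (p, x)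
      else if act = pass then 1 - β.prob 1 (m + 1) t ζ (p, x) else 0
  | n + 1, m + 1 => fun ζ p x =>
      Γ.select t (p, x)
        (roundGame M (gameValue M Γ β (M.T - (t + 1)) (n + 1) (m + 1))
          (gameValue M Γ β (M.T - t) (n + 1) m) (gameValue M Γ β (M.T - t) n (m + 1))
          (gameValue M Γ β (M.T - t) n m) ζ p x)

/-- The pair of signals drawn from the lottery `γ` by means of a uniform variate `y`. -/
def draw (γ : Lottery) (y : ℝ) : Profile :=
  if y < γ ![true, true] then ![true, true]
  else if y < γ ![true, true] + γ ![true, false] then ![true, false]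
  else if y < γ ![true, true] + γ ![true, false] + γ ![false, true] then ![false, true]
  else ![false, false]

/-! ### Plays of the switching game -/

/-- The exogenous randomness. At stage `t` the game is played in rounds `r = 0, 1, …`; the third
party draws the signals of round `(t, r)` from `η t r`, and `ε t` drives the prices from stage `t`
to stage `t + 1`. The `σ`-algebra `𝓖 (t, r)` (lexicographic time) is everything that happened
before round `(t, r)`, together with any private randomization that is independent of the future
of `η` and `ε`. -/
structure Environment {Ω : Type*} [mΩ : MeasurableSpace Ω] (Pr : Measure Ω) where
  ε : ℕ → Ω → ℝ × ℝ
  η : ℕ → ℕ → Ω → ℝ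
  𝓖 : Filtration (ℕ ×ₗ ℕ) mΩ
  measurable_ε : ∀ t, Measurable[𝓖 (toLex (t + 1, 0))] (ε t)
  law_ε : ∀ t, Pr.map (ε t) = noiseLaw
  indep_ε : ∀ t r, Indep (𝓖 (toLex (t, r))) (MeasurableSpace.comap (ε t) inferInstance) Pr
  measurable_η : ∀ t r, Measurable[𝓖 (toLex (t, r + 1))] (η t r)
  law_η : ∀ t r, Pr.map (η t r) = volume.restrict (Set.Icc (0 : ℝ) 1)
  indep_η : ∀ t r, Indep (𝓖 (toLex (t, r))) (MeasurableSpace.comap (η t r) inferInstance) Pr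

/-- A strategy of one player: the action in round `r` of stage `t` as a function of the
elementary event and of the signal that she has received in this round. -/
abbrev Strategy (Ω : Type*) := ℕ → ℕ → Ω → Bool → Bool

/-- The strategy that follows the signals of the third party. -/
def obey {Ω : Type*} : Strategy Ω := fun _ _ _ μ => μ

/-- The strategy uses only past information, private randomization and the player's own signal,
i.e. the action in round `(t, r)` is measurable for `𝓖 (t, r) ∨ σ(μ_i(t, r))`. -/
def Strategy.IsAdapted {Ω : Type*} [mΩ : MeasurableSpace Ω] {Pr : Measure Ω}
    (D : Strategy Ω) (E : Environment Pr) : Prop :=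
  ∀ t r μ, Measurable[E.𝓖 (toLex (t, r))] (fun ω => D t r ω μ)

/-- The position during a play: prices, regimes, numbers of switches used so far, and whether the
present stage is still open (nobody having switched in a round closes the stage). -/
structure Position where
  p : ℝ
  x : ℝ
  reg : Profile
  used : Fin 2 → ℕ
  isOpen : Bool

/-- An instance of the `(n, m)`-restricted switching game: a market, the law `Γ` and the
single-player controls `β` that determine the device, the numbers `n`, `m` of switches allowed,
and the initial stage `s`, prices `p`, `x` and regimes `ζ`. -/
structure Setup where
  M : Market
  Γ : CorrelationLaw
  β : SoloControl M
  n : ℕ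
  m : ℕ
  s : ℕ
  p : ℝ
  x : ℝ
  ζ : Profile

namespace Setup

variable (A : Setup) {Ω : Type*} [mΩ : MeasurableSpace Ω] {Pr : Measure Ω}

/-- The number of switches allowed to each player. -/
def budget : Fin 2 → ℕ := ![A.n, A.m]

/-- One round: the device `γ^{n,m}` looks at the switches left, the latest regimes and the prices,
signals are sent, and the players act (actions are void once the stage is closed). -/
def playRound (E : Environment Pr) (D : Fin 2 → Strategy Ω) (t r : ℕ) (ω : Ω) (S : Position) :
    Position :=
  let γ := device A.M A.Γ A.β t (A.n - S.used 0) (A.m - S.used 1) S.reg S.p S.x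
  let μ := draw γ (E.η t r ω)
  let act : Profile := fun i => S.isOpen && D i t r ω (μ i)
  { p := S.p
    x := S.x
    reg := toggle S.reg act
    used := fun i => S.used i + (act i).toNat
    isOpen := act 0 || act 1 }

/-- The position before round `r` of a stage `t` that begins in position `S`. -/
def playRounds (E : Environment Pr) (D : Fin 2 → Strategy Ω) (t : ℕ) (ω : Ω) (S : Position) :
    ℕ → Position
  | 0 => S
  | r + 1 => A.playRound E D t r ω (playRounds E D t ω S r)

/-- The position at the beginning of stage `s + q`. There are `n + m` rounds in a stage, which
suffices to make all permitted switches. -/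
def start (E : Environment Pr) (D : Fin 2 → Strategy Ω) (ω : Ω) : ℕ → Position
  | 0 => { p := A.p, x := A.x, reg := A.ζ, used := fun _ => 0, isOpen := true }
  | q + 1 =>
      let S := A.playRounds E D (A.s + q) ω (start E D ω q) (A.n + A.m)
      { p := A.M.G S.p (E.ε (A.s + q) ω).1
        x := A.M.nextX S.reg S.x (E.ε (A.s + q) ω)
        reg := S.reg
        used := S.used
        isOpen := true }

/-- The position before round `r` of stage `s + q`. -/
def position (E : Environment Pr) (D : Fin 2 → Strategy Ω) (ω : Ω) (q r : ℕ) : Position :=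
  A.playRounds E D (A.s + q) ω (A.start E D ω q) r

/-- The regime `u_i(s + q)` in which player `i` produces at stage `s + q`. -/
def control (E : Environment Pr) (D : Fin 2 → Strategy Ω) (i : Fin 2) (q : ℕ) (ω : Ω) : Bool :=
  (A.position E D ω q (A.n + A.m)).reg i

/-- The regime `u_i((s + q)-)` of player `i` just before stage `s + q`. -/
def controlBefore (E : Environment Pr) (D : Fin 2 → Strategy Ω) (i : Fin 2) (q : ℕ) (ω : Ω) :
    Bool :=
  (A.start E D ω q).reg i

/-- The cumulative net profit of player `i`, switching costs being charged for the change of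
regime `u_i(t-) → u_i(t)` at each stage. -/
def netPayoff (E : Environment Pr) (D : Fin 2 → Strategy Ω) (i : Fin 2) (ω : Ω) : ℝ :=
  ∑ q ∈ Finset.range (A.M.T - A.s),
    (A.M.profit i (A.start E D ω q).p (A.start E D ω q).x * level (A.control E D i q ω) * A.M.dt
      - A.M.K i (A.controlBefore E D i q ω) (A.control E D i q ω))

/-- The cumulative net profit of player `i`, switching costs being charged for each single
switch. -/
def payoff (E : Environment Pr) (D : Fin 2 → Strategy Ω) (i : Fin 2) (ω : Ω) : ℝ :=
  ∑ q ∈ Finset.range (A.M.T - A.s),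
    (A.M.profit i (A.start E D ω q).p (A.start E D ω q).x * level (A.control E D i q ω) * A.M.dt
      - ∑ r ∈ Finset.range (A.n + A.m),
          A.M.K i ((A.position E D ω q r).reg i) ((A.position E D ω q (r + 1)).reg i))

/-- Both players follow the device: the controls `(u_1^{n,m}, u_2^{n,m})`. -/
def equilibrium : Fin 2 → Strategy Ω := fun _ => obey

/-- Player `i` uses `D`, the other player follows the device. -/
def deviation (i : Fin 2) (D : Strategy Ω) : Fin 2 → Strategy Ω :=
  Function.update (fun _ => obey) i D

/-- `D` is an admissible strategy of player `i` in the restricted game, against an opponent who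
follows the device: it is adapted and makes at most `n` (resp. `m`) switches. -/
def IsAdmissible (E : Environment Pr) (i : Fin 2) (D : Strategy Ω) : Prop :=
  Strategy.IsAdapted D E ∧
    ∀ᵐ ω ∂Pr, (A.start E (deviation i D) ω (A.M.T - A.s)).used i ≤ A.budget i

/-- `D` makes at most one switch per stage. -/
def IsOncePerStage (E : Environment Pr) (i : Fin 2) (D : Strategy Ω) : Prop :=
  ∀ᵐ ω ∂Pr, ∀ q < A.M.T - A.s,
    (A.start E (deviation i D) ω (q + 1)).used i ≤ (A.start E (deviation i D) ω q).used i + 1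

end Setup

end EmissionGame

end

namespace EmissionGame

open scoped NNReal

/-! ### Growth of the values in the prices -/

/-! The proof is a martingale argument in the two-level time (stage, round). Follow the value of the
cascade along the play, together with the profits earned and the switching costs paid so far. If
both players obey, this process is a martingale. If player `i` deviates, it is a supermartingale for
her. It starts at the value `Ĵ` and ends at the total payoff, so obedience earns `Ĵ` and a deviation
at most `Ĵ`.

The supermartingale property is checked round by round. Given the past, a deviation is a fixed
reaction `d` to the player's own signal, and the variate that draws the signals is independent of
the past. It can therefore be integrated out with the past frozen (`integral_comp_of_indep`,
`integral_draw`), and what remains is a statement about a finite lottery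
(`sum_device_mul_roundValue_update_le`). If both players have switches left, that statement is the
correlated equilibrium inequality. If only the deviator has some, it is her Bellman equation. If she
has none, she is never told to switch and must not switch. Under obedience equality holds
(`sum_device_mul_roundValue`). Between stages, the value of holding is by definition the current
profit plus the expected next value. `integral_payoff` telescopes all this; `n + m` rounds per stage
suffice by `potential_last`.

Integrability is needed throughout. Profits are bounded above, and their negative part is controlled
by the negative part of `p` and by `x`. One period turns a power of `x` into a lognormal factor
times another power, with exponent multiplied by `1 - κδ`. The functions `scale` collect these
powers and the expected shortfalls, and all values are dominated by them (`Tame`).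

If only net changes of regime are charged, the triangle inequality can only raise the equilibrium
payoff. A deviator who switches at most once per stage pays the same under both conventions, so the
second assertion follows from the first. -/

instance isProbabilityMeasure_noiseLaw : IsProbabilityMeasure noiseLaw := by
  unfold noiseLaw; infer_instance

theorem lintegral_exp_noiseLaw_lt_top (c a b : ℝ) :
    ∫⁻ e, ENNReal.ofReal (Real.exp (c + a * e.1 + b * e.2)) ∂noiseLaw < ⊤ := by
  have h : Integrable (fun e : ℝ × ℝ => Real.exp (c + a * e.1 + b * e.2)) noiseLaw := by
    have h1 : Integrable (fun e : ℝ × ℝ => Real.exp (a * e.1) * Real.exp (b * e.2)) noiseLaw :=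
      (integrable_exp_mul_gaussianReal a).mul_prod (integrable_exp_mul_gaussianReal b)
    convert h1.const_mul (Real.exp c) using 2 with e
    rw [Real.exp_add, Real.exp_add, mul_assoc]
  exact h.lintegral_lt_top

theorem lintegral_fst_noiseLaw {f : ℝ → ℝ≥0∞} (hf : Measurable f) :
    ∫⁻ e, f e.1 ∂noiseLaw = ∫⁻ e, f e ∂(gaussianReal 0 1) := by
  unfold noiseLaw
  rw [lintegral_prod _ (by fun_prop)]
  simp

theorem measurable_priceShortfall {G : ℝ → ℝ → ℝ} (hG : Measurable (Function.uncurry G)) (t : ℕ) :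
    Measurable (priceShortfall G t) := by
  induction t with
  | zero =>
    change Measurable (fun p : ℝ => ENNReal.ofReal (-p))
    fun_prop
  | succ t ih =>
    exact Measurable.lintegral_prod_right' (f := fun y : ℝ × ℝ => priceShortfall G t (G y.1 y.2))
      (ih.comp hG)

namespace Market

variable (M : Market)

/-- The factor by which mean reversion contracts the logarithmic allowance price. -/
noncomputable def contraction : ℝ := 1 - M.κ * M.dt

/-- A scale of growth functions of the prices that is stable under the evolution of the prices. -/
noncomputable def scale (N : ℕ) (p x : ℝ) : ℝ≥0∞ :=
  1 + ∑ k ∈ Finset.range N,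
    (priceShortfall M.G k p + ENNReal.ofReal (x ^ (M.contraction ^ k)))

theorem measurable_scale (N : ℕ) : Measurable (fun y : ℝ × ℝ => M.scale N y.1 y.2) := by
  unfold scale
  refine Measurable.const_add (Finset.measurable_fun_sum (f := fun k (y : ℝ × ℝ) =>
    priceShortfall M.G k y.1 + ENNReal.ofReal (y.2 ^ (M.contraction ^ k))) _ fun k _ => ?_) 1
  have h : Measurable (fun y : ℝ × ℝ => ENNReal.ofReal (y.2 ^ (M.contraction ^ k))) := by fun_prop
  exact ((measurable_priceShortfall M.measurable_G k).comp measurable_fst).add h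

theorem scale_lt_top (N : ℕ) (p x : ℝ) : M.scale N p x < ⊤ := by
  unfold scale
  refine ENNReal.add_lt_top.2 ⟨ENNReal.one_lt_top, ENNReal.sum_lt_top.2 fun k _ => ?_⟩
  exact ENNReal.add_lt_top.2 ⟨M.shortfall_finite k p, ENNReal.ofReal_lt_top⟩

theorem scale_mono {N N' : ℕ} (h : N ≤ N') (p x : ℝ) : M.scale N p x ≤ M.scale N' p x := by
  unfold scale
  gcongr

theorem measurable_nextX (u : Profile) :
    Measurable (fun y : ℝ × (ℝ × ℝ) => M.nextX u y.1 y.2) := by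
  unfold nextX; fun_prop

theorem nextX_pos (u : Profile) {x : ℝ} (hx : 0 < x) (e : ℝ × ℝ) : 0 < M.nextX u x e :=
  mul_pos hx (Real.exp_pos _)

theorem measurable_nextPrices (u : Profile) :
    Measurable (fun y : (ℝ × ℝ) × (ℝ × ℝ) => (M.G y.1.1 y.2.1, M.nextX u y.1.2 y.2)) := by
  refine Measurable.prodMk (M.measurable_G.comp (by fun_prop : Measurable
    (fun y : (ℝ × ℝ) × (ℝ × ℝ) => (y.1.1, y.2.1)))) ?_
  exact (M.measurable_nextX u).comp (by fun_prop : Measurable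
    (fun y : (ℝ × ℝ) × (ℝ × ℝ) => (y.1.2, y.2)))

/-- The logarithm of the next price is affine in `log x` with slope `contraction`. This is why the
exponents in `scale` are the powers `contraction ^ k`; no sign of `contraction` is assumed, and the
Gaussian factor has finite expectation for every `q`. -/
theorem nextX_rpow (u : Profile) {x : ℝ} (hx : 0 < x) (e : ℝ × ℝ) (q : ℝ) :
    M.nextX u x e ^ q = Real.exp (q * (M.κ * M.f u * M.dt) + q * M.σ * (M.ρ) * e.1
      + q * M.σ * √(1 - M.ρ ^ 2) * e.2) * x ^ (q * M.contraction) := by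
  rw [Real.rpow_def_of_pos (M.nextX_pos u hx e), Real.rpow_def_of_pos hx, ← Real.exp_add]
  unfold nextX contraction
  rw [Real.log_mul hx.ne' (Real.exp_pos _).ne', Real.log_exp]
  congr 1
  ring

/-- The prices grow by at most a constant factor and one step along the scale. -/
theorem lintegral_scale_next (N : ℕ) : ∃ C : ℝ≥0, ∀ (u : Profile) (p x : ℝ), 0 < x →
    ∫⁻ e, M.scale N (M.G p e.1) (M.nextX u x e) ∂noiseLaw ≤ C * M.scale (N + 1) p x := by
  set c : Profile → ℕ → ℝ≥0∞ := fun u k => ∫⁻ e : ℝ × ℝ, ENNReal.ofReal (Real.exp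
    (M.contraction ^ k * (M.κ * M.f u * M.dt) + M.contraction ^ k * M.σ * M.ρ * e.1
      + M.contraction ^ k * M.σ * √(1 - M.ρ ^ 2) * e.2)) ∂noiseLaw with hc
  have hfin : 1 + ∑ u, ∑ k ∈ Finset.range N, c u k < ⊤ := by
    refine ENNReal.add_lt_top.2 ⟨ENNReal.one_lt_top, ENNReal.sum_lt_top.2 fun u _ =>
      ENNReal.sum_lt_top.2 fun k _ => ?_⟩
    exact lintegral_exp_noiseLaw_lt_top _ _ _
  -- Summing over all regimes makes the constant uniform in `u`. The summand `1` gives `1 ≤ C`,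
  -- which absorbs the constant term and the shortfall terms.
  refine ⟨(1 + ∑ u, ∑ k ∈ Finset.range N, c u k).toNNReal, fun u p x hx => ?_⟩
  rw [ENNReal.coe_toNNReal hfin.ne]
  set C := 1 + ∑ u, ∑ k ∈ Finset.range N, c u k with hC
  have hC1 : 1 ≤ C := by rw [hC]; exact le_self_add
  have hCk : ∀ k ∈ Finset.range N, c u k ≤ C := by
    intro k hk
    calc c u k ≤ ∑ k ∈ Finset.range N, c u k :=
          Finset.single_le_sum (f := c u) (fun _ _ => zero_le) hk
      _ ≤ ∑ u, ∑ k ∈ Finset.range N, c u k :=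
          Finset.single_le_sum (f := fun u => ∑ k ∈ Finset.range N, c u k)
            (fun _ _ => zero_le) (Finset.mem_univ u)
      _ ≤ C := by rw [hC]; exact le_add_self
  have hGm : Measurable (fun e : ℝ => M.G p e) := M.measurable_G.comp
    (by fun_prop : Measurable (fun e : ℝ => (p, e)))
  have hG' : Measurable (fun e : ℝ × ℝ => M.G p e.1) := hGm.comp measurable_fst
  have hX : Measurable (fun e : ℝ × ℝ => M.nextX u x e) :=
    (M.measurable_nextX u).comp (by fun_prop : Measurable (fun e : ℝ × ℝ => (x, e)))
  have hP : ∀ k, Measurable (fun e : ℝ × ℝ => priceShortfall M.G k (M.G p e.1)) :=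
    fun k => (measurable_priceShortfall M.measurable_G k).comp hG'
  have hXk : ∀ k, Measurable
      (fun e : ℝ × ℝ => ENNReal.ofReal (M.nextX u x e ^ M.contraction ^ k)) :=
    fun k => by fun_prop
  unfold scale
  rw [lintegral_add_left measurable_const, lintegral_finsetSum _
    (fun k _ => show Measurable (fun e : ℝ × ℝ => priceShortfall M.G k (M.G p e.1)
      + ENNReal.ofReal (M.nextX u x e ^ M.contraction ^ k)) from (hP k).add (hXk k))]
  simp only [lintegral_const, measure_univ, mul_one]
  rw [mul_add, mul_one, Finset.mul_sum]
  refine add_le_add hC1 ?_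
  calc ∑ k ∈ Finset.range N, ∫⁻ e : ℝ × ℝ, (priceShortfall M.G k (M.G p e.1)
        + ENNReal.ofReal (M.nextX u x e ^ M.contraction ^ k)) ∂noiseLaw
      ≤ ∑ k ∈ Finset.range N, C * (priceShortfall M.G (k + 1) p
        + ENNReal.ofReal (x ^ M.contraction ^ (k + 1))) := by
        refine Finset.sum_le_sum fun k hk => ?_
        rw [lintegral_add_left (hP k), mul_add]
        refine add_le_add ?_ ?_
        · rw [lintegral_fst_noiseLaw (f := fun e => priceShortfall M.G k (M.G p e))
            ((measurable_priceShortfall M.measurable_G k).comp hGm)]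
          exact le_mul_of_one_le_left zero_le hC1
        · simp_rw [M.nextX_rpow u hx]
          have : ∀ e : ℝ × ℝ, ENNReal.ofReal (Real.exp
              (M.contraction ^ k * (M.κ * M.f u * M.dt) + M.contraction ^ k * M.σ * M.ρ * e.1
              + M.contraction ^ k * M.σ * √(1 - M.ρ ^ 2) * e.2)
              * x ^ (M.contraction ^ k * M.contraction)) = ENNReal.ofReal (Real.exp
              (M.contraction ^ k * (M.κ * M.f u * M.dt) + M.contraction ^ k * M.σ * M.ρ * e.1
              + M.contraction ^ k * M.σ * √(1 - M.ρ ^ 2) * e.2))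
              * ENNReal.ofReal (x ^ M.contraction ^ (k + 1)) := fun e => by
            rw [ENNReal.ofReal_mul (Real.exp_pos _).le, pow_succ M.contraction]
          simp_rw [this]
          rw [lintegral_mul_const _ (by fun_prop)]
          exact mul_le_mul_left (hCk k hk) _
    _ ≤ _ := by
        -- The shifted sum is that of `scale (N + 1)` without its term `k = 0`, which is dropped.
        rw [Finset.sum_range_succ']
        exact le_self_add

/-- `w` is a measurable function of the prices that grows at most like some member of the scale. -/
def Tame (w : ℝ → ℝ → ℝ) : Prop :=
  Measurable (fun y : ℝ × ℝ => w y.1 y.2) ∧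
    ∃ (C : ℝ≥0) (N : ℕ), ∀ p x, 0 < x → ‖w p x‖ₑ ≤ C * M.scale N p x

variable {M}

theorem Tame.mono {v w : ℝ → ℝ → ℝ} (hw : M.Tame w)
    (hv : Measurable (fun y : ℝ × ℝ => v y.1 y.2)) (h : ∀ p x, |v p x| ≤ |w p x|) : M.Tame v := by
  obtain ⟨-, C, N, hb⟩ := hw
  refine ⟨hv, C, N, fun p x hx => le_trans ?_ (hb p x hx)⟩
  simp only [← ofReal_norm, Real.norm_eq_abs]
  exact ENNReal.ofReal_le_ofReal (h p x)

theorem Tame.add {v w : ℝ → ℝ → ℝ} (hv : M.Tame v) (hw : M.Tame w) :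
    M.Tame (fun p x => v p x + w p x) := by
  obtain ⟨hvm, C, N, hb⟩ := hv
  obtain ⟨hwm, C', N', hb'⟩ := hw
  refine ⟨hvm.add hwm, C + C', N + N', fun p x hx => ?_⟩
  calc ‖v p x + w p x‖ₑ ≤ ‖v p x‖ₑ + ‖w p x‖ₑ := enorm_add_le _ _
    _ ≤ C * M.scale N p x + C' * M.scale N' p x := add_le_add (hb p x hx) (hb' p x hx)
    _ ≤ C * M.scale (N + N') p x + C' * M.scale (N + N') p x := by
        gcongr <;> apply M.scale_mono <;> omega
    _ = _ := by push_cast; ring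

theorem tame_const (c : ℝ) : M.Tame (fun _ _ => c) := by
  refine ⟨measurable_const, ‖c‖₊, 0, fun p x _ => ?_⟩
  simp [scale, enorm_eq_nnnorm]

theorem Tame.abs {w : ℝ → ℝ → ℝ} (hw : M.Tame w) : M.Tame (fun p x => |w p x|) :=
  hw.mono (measurable_abs.comp hw.1) (by simp)

theorem Tame.sub_const {w : ℝ → ℝ → ℝ} (hw : M.Tame w) (c : ℝ) :
    M.Tame (fun p x => w p x - c) := by
  simpa only [sub_eq_add_neg] using hw.add (tame_const (-c))

theorem Tame.sum {ι : Type*} {s : Finset ι} {w : ι → ℝ → ℝ → ℝ} (hw : ∀ i ∈ s, M.Tame (w i)) :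
    M.Tame (fun p x => ∑ i ∈ s, w i p x) := by
  classical
  induction s using Finset.induction_on with
  | empty => simpa using tame_const 0
  | insert a s ha ih =>
    simp only [Finset.sum_insert ha]
    exact (hw a (by simp)).add (ih fun i hi => hw i (by simp [hi]))

theorem Tame.max {v w : ℝ → ℝ → ℝ} (hv : M.Tame v) (hw : M.Tame w) :
    M.Tame (fun p x => max (v p x) (w p x)) := by
  refine (hv.abs.add hw.abs).mono (hv.1.max hw.1) fun p x => ?_
  refine le_trans (abs_max_le_max_abs_abs) ?_
  rw [abs_of_nonneg (by positivity : (0 : ℝ) ≤ |v p x| + |w p x|)]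
  exact max_le (by linarith [abs_nonneg (w p x)]) (by linarith [abs_nonneg (v p x)])

theorem Tame.mul_bounded {w : ℝ → ℝ → ℝ} (hw : M.Tame w) {q : ℝ × ℝ → ℝ} (hq : Measurable q)
    (h : ∀ y, q y ∈ Set.Icc (0 : ℝ) 1) : M.Tame (fun p x => q (p, x) * w p x) := by
  refine hw.mono (hq.mul hw.1) fun p x => ?_
  rw [abs_mul, abs_of_nonneg (h _).1]
  exact mul_le_of_le_one_left (abs_nonneg _) (h _).2

theorem Tame.const_mul {w : ℝ → ℝ → ℝ} (hw : M.Tame w) (c : ℝ) :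
    M.Tame (fun p x => c * w p x) := by
  obtain ⟨hm, C, N, hb⟩ := hw
  refine ⟨hm.const_mul c, ‖c‖₊ * C, N, fun p x hx => ?_⟩
  rw [enorm_mul, enorm_eq_nnnorm c, ENNReal.coe_mul, mul_assoc]
  exact mul_le_mul_right (hb p x hx) _

/-- Truncation bounds the profit above by `cap`. Since `a i ≥ 0`, large positive `p` does no harm
below, so only the negative part of `p` enters; for `x > 0`, `scale 1` is `1 + p⁻ + x`. -/
theorem tame_profit (i : Fin 2) : M.Tame (M.profit i) := by
  refine ⟨by unfold profit; fun_prop, (|M.cap| + M.a i + |M.b i| + |M.c i|).toNNReal, 1,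
    fun p x hx => ?_⟩
  have ha := M.a_nonneg i
  have hs : M.scale 1 p x = ENNReal.ofReal (1 + (max (-p) 0 + x)) := by
    rw [ENNReal.ofReal_add (by norm_num) (by positivity), ENNReal.ofReal_add (by positivity) hx.le]
    simp only [scale, Finset.sum_range_one, pow_zero, Real.rpow_one, priceShortfall,
      ENNReal.ofReal_one]
    rw [ENNReal.ofReal_max]
    simp
  rw [hs, ← ofReal_norm, Real.norm_eq_abs]
  change _ ≤ ENNReal.ofReal _ * _
  rw [← ENNReal.ofReal_mul (by positivity)]
  refine ENNReal.ofReal_le_ofReal ?_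
  have hp0 : 0 ≤ max (-p) 0 := le_max_right _ _
  have h1 : |M.profit i p x| ≤ |M.cap| + M.a i * max (-p) 0 + |M.b i| * x + |M.c i| := by
    have e1 : -(M.a i * max (-p) 0) ≤ M.a i * p := by
      have := mul_le_mul_of_nonneg_left (le_max_left (-p) 0) ha
      linarith
    have e2 : M.b i * x ≤ |M.b i| * x := mul_le_mul_of_nonneg_right (le_abs_self _) hx.le
    have e3 : 0 ≤ |M.b i| * x := by positivity
    have e4 : 0 ≤ M.a i * max (-p) 0 := by positivity
    have e5 := le_abs_self (M.c i)
    have e6 := le_abs_self (M.cap)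
    have e7 := abs_nonneg (M.c i)
    have e8 := neg_abs_le (M.cap)
    unfold profit
    rw [abs_le]
    constructor
    · rw [le_min_iff]; constructor <;> linarith
    · exact (min_le_left _ _).trans (by linarith)
  refine h1.trans ?_
  have f1 := abs_nonneg M.cap
  have f2 := abs_nonneg (M.b i)
  have f3 := abs_nonneg (M.c i)
  have g1 : 0 ≤ |M.cap| * (max (-p) 0 + x) := by positivity
  have g2 : 0 ≤ M.a i * (1 + x) := by positivity
  have g3 : 0 ≤ |M.b i| * (1 + max (-p) 0) := by positivity
  have g4 : 0 ≤ |M.c i| * (max (-p) 0 + x) := by positivity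
  nlinarith

/-- Each conditional expectation costs one step of the scale, from `N` to `N + 1`. Together with
stability under sums, maxima and mixtures, this lets tameness pass through every recursion of the
cascade. -/
theorem Tame.hold {w : ℝ → ℝ → ℝ} (hw : M.Tame w) (i : Fin 2) (ζ : Profile) :
    M.Tame (fun p x => M.hold i ζ p x w) := by
  have h1 : M.Tame (fun p x => M.profit i p x * level (ζ i) * M.dt) := by
    convert (tame_profit (M := M) i).const_mul (level (ζ i) * M.dt) using 3
    ring
  refine h1.add ?_
  obtain ⟨hm, C, N, hb⟩ := hw
  obtain ⟨C', hC'⟩ := M.lintegral_scale_next N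
  refine ⟨?_, C * C', N + 1, fun p x hx => ?_⟩
  · have : StronglyMeasurable (fun z : (ℝ × ℝ) × (ℝ × ℝ) =>
        w (M.G z.1.1 z.2.1) (M.nextX ζ z.1.2 z.2)) :=
      (hm.comp (M.measurable_nextPrices ζ)).stronglyMeasurable
    exact (this.integral_prod_right' (ν := noiseLaw)).measurable
  · calc ‖∫ e, w (M.G p e.1) (M.nextX ζ x e) ∂noiseLaw‖ₑ
        ≤ ∫⁻ e, ‖w (M.G p e.1) (M.nextX ζ x e)‖ₑ ∂noiseLaw := enorm_integral_le_lintegral_enorm _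
      _ ≤ ∫⁻ e, C * M.scale N (M.G p e.1) (M.nextX ζ x e) ∂noiseLaw :=
          lintegral_mono fun e => hb _ _ (M.nextX_pos ζ hx e)
      _ = C * ∫⁻ e, M.scale N (M.G p e.1) (M.nextX ζ x e) ∂noiseLaw := by
          refine lintegral_const_mul _ ?_
          exact (M.measurable_scale N).comp ((M.measurable_nextPrices ζ).comp
            (by fun_prop : Measurable (fun e : ℝ × ℝ => ((p, x), e))))
      _ ≤ C * (C' * M.scale (N + 1) p x) := by gcongr; exact hC' ζ p x hx
      _ = _ := by push_cast; ring

end Market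

/-! ### Regularity of the values and of the device -/

theorem pass_eq : pass = ![false, false] := by decide

theorem only_zero : only 0 = ![true, false] := by decide

theorem only_one : only 1 = ![false, true] := by decide

theorem sum_profile (f : Profile → ℝ) : ∑ a, f a =
    f ![false, false] + f ![false, true] + f ![true, false] + f ![true, true] := by
  have h : (Finset.univ : Finset Profile) =
      {![false, false], ![false, true], ![true, false], ![true, true]} := by decide
  rw [h, Finset.sum_insert (by decide), Finset.sum_insert (by decide),
    Finset.sum_insert (by decide), Finset.sum_singleton]
  ring

theorem profile_cases (a : Profile) : a = ![false, false] ∨ a = ![false, true] ∨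
    a = ![true, false] ∨ a = ![true, true] := by
  revert a; decide

section Values

variable (M : Market) (Γ : CorrelationLaw) (β : SoloControl M)

theorem IsCEP.le_one {H : Game} {γ : Lottery} (h : IsCEP H γ) (a : Profile) : γ a ≤ 1 := by
  rw [← h.2.1]
  exact Finset.single_le_sum (f := γ) (fun a _ => h.1 a) (Finset.mem_univ a)

theorem tame_soloValue (i : Fin 2) (h n : ℕ) (ζ : Profile) : M.Tame (soloValue M i h n ζ) := by
  induction h generalizing n ζ with
  | zero =>
    have : soloValue M i 0 n ζ = fun _ _ => 0 := by funext p x; rw [soloValue]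
    rw [this]; exact Market.tame_const 0
  | succ h ihh =>
    induction n generalizing ζ with
    | zero =>
      have : soloValue M i (h + 1) 0 ζ = fun p x => M.hold i ζ p x (soloValue M i h 0 ζ) := by
        funext p x; rw [soloValue]
      rw [this]; exact (ihh 0 ζ).hold i ζ
    | succ n ihn =>
      have : soloValue M i (h + 1) (n + 1) ζ = fun p x =>
          max (M.hold i ζ p x (soloValue M i h (n + 1) ζ))
            (soloValue M i (h + 1) n (toggle ζ (only i)) p x - M.K i (ζ i) (!ζ i)) := by
        funext p x; rw [soloValue]
      rw [this]
      exact ((ihh (n + 1) ζ).hold i ζ).max ((ihn _).sub_const _)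

variable {M}

theorem Market.Tame.mix {v w : ℝ → ℝ → ℝ} (hv : M.Tame v) (hw : M.Tame w) {q : ℝ × ℝ → ℝ}
    (hq : Measurable q) (h : ∀ y, q y ∈ Set.Icc (0 : ℝ) 1) :
    M.Tame (fun p x => (1 - q (p, x)) * v p x + q (p, x) * w p x) :=
  (hv.mul_bounded (q := fun y => 1 - q y) (by fun_prop)
    fun y => ⟨by linarith [(h y).2], by linarith [(h y).1]⟩).add (hw.mul_bounded hq h)

theorem tame_roundGame {w₀₀ w₀₁ w₁₀ w₁₁ : Value}
    (h₀₀ : ∀ ζ i, M.Tame (fun p x => w₀₀ ζ p x i)) (h₀₁ : ∀ ζ i, M.Tame (fun p x => w₀₁ ζ p x i))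
    (h₁₀ : ∀ ζ i, M.Tame (fun p x => w₁₀ ζ p x i)) (h₁₁ : ∀ ζ i, M.Tame (fun p x => w₁₁ ζ p x i))
    (ζ act : Profile) (i : Fin 2) :
    M.Tame (fun p x => roundGame M w₀₀ w₀₁ w₁₀ w₁₁ ζ p x act i) := by
  unfold roundGame
  rcases profile_cases act with h | h | h | h <;> subst h <;> simp only [Matrix.cons_val_zero,
    Matrix.cons_val_one]
  · exact (h₀₀ _ _).hold _ _
  · exact (h₀₁ _ _).sub_const _
  · exact (h₁₀ _ _).sub_const _
  · exact (h₁₁ _ _).sub_const _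

theorem measurable_select_comp {H : ℝ → ℝ → Game}
    (hH : ∀ a i, M.Tame (fun p x => H p x a i)) (t : ℕ) (a : Profile) :
    Measurable (fun y : ℝ × ℝ => Γ.select t y (H y.1 y.2) a) := by
  have h1 : Measurable (fun y : ℝ × ℝ => H y.1 y.2) :=
    measurable_pi_iff.2 fun a => measurable_pi_iff.2 fun i => (hH a i).1
  exact (measurable_pi_apply a).comp ((Γ.measurable_select t).comp (measurable_id.prodMk h1))

theorem tame_gameValue (h n m : ℕ) (ζ : Profile) (i : Fin 2) :
    M.Tame (fun p x => gameValue M Γ β h n m ζ p x i) := by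
  induction h generalizing n m ζ i with
  | zero => simp only [gameValue]; exact Market.tame_const 0
  | succ h ihh =>
    induction n generalizing m ζ i with
    | zero =>
      induction m generalizing ζ i with
      | zero => simp only [gameValue]; exact (ihh _ _ _ _).hold _ _
      | succ m ihm =>
        simp only [gameValue]
        split_ifs
        · exact tame_soloValue _ _ _ _ _
        · exact ((ihh _ _ _ _).hold _ _).mix (ihm _ _) (β.measurable_prob _ _ _ _)
            (β.prob_mem _ _ _ _)
    | succ n ihn =>
      induction m generalizing ζ i with
      | zero =>
        simp only [gameValue]
        split_ifs
        · exact tame_soloValue _ _ _ _ _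
        · exact ((ihh _ _ _ _).hold _ _).mix (ihn _ _ _) (β.measurable_prob _ _ _ _)
            (β.prob_mem _ _ _ _)
      | succ m ihm =>
        simp only [gameValue]
        have hH := tame_roundGame (ihh (n + 1) (m + 1)) ihm (ihn (m + 1)) (ihn m) ζ
        refine Market.Tame.sum fun a _ => (hH a i).mul_bounded
          (measurable_select_comp Γ hH _ a) fun y => ⟨?_, ?_⟩
        · exact (Γ.isCEP _ _ _).1 a
        · exact (Γ.isCEP _ _ _).le_one a

theorem measurable_device (t n m : ℕ) (ζ a : Profile) :
    Measurable (fun y : ℝ × ℝ => device M Γ β t n m ζ y.1 y.2 a) := by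
  rcases n with _ | n <;> rcases m with _ | m <;> simp only [device]
  · exact measurable_const
  · have := β.measurable_prob 1 (m + 1) t ζ
    split_ifs
    · exact this
    · exact this.const_sub 1
    · exact measurable_const
  · have := β.measurable_prob 0 (n + 1) t ζ
    split_ifs
    · exact this
    · exact this.const_sub 1
    · exact measurable_const
  · exact measurable_select_comp Γ (tame_roundGame (tame_gameValue Γ β _ _ _)
      (tame_gameValue Γ β _ _ _) (tame_gameValue Γ β _ _ _) (tame_gameValue Γ β _ _ _) ζ) _ _

theorem device_nonneg (t n m : ℕ) (ζ : Profile) (p x : ℝ) (a : Profile) :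
    0 ≤ device M Γ β t n m ζ p x a := by
  rcases n with _ | n <;> rcases m with _ | m <;> simp only [device]
  · split_ifs <;> norm_num
  · have := β.prob_mem 1 (m + 1) t ζ (p, x)
    split_ifs
    · exact this.1
    · linarith [this.2]
    · rfl
  · have := β.prob_mem 0 (n + 1) t ζ (p, x)
    split_ifs
    · exact this.1
    · linarith [this.2]
    · rfl
  · exact (Γ.isCEP _ _ _).1 a

theorem device_sum (t n m : ℕ) (ζ : Profile) (p x : ℝ) : ∑ a, device M Γ β t n m ζ p x a = 1 := by
  rcases n with _ | n <;> rcases m with _ | m <;> simp only [device]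
  · simp
  · rw [sum_profile, only_one, pass_eq]; simp
  · rw [sum_profile, only_zero, pass_eq]; simp
  · exact (Γ.isCEP _ _ _).2.1

/-- This gives access to the optimality of `β`. Only `n = 0` needs the induction hypothesis: there
both sides satisfy the same holding recursion. -/
theorem gameValue_eq_soloValue_zero (h n : ℕ) (ζ : Profile) (p x : ℝ) :
    gameValue M Γ β h n 0 ζ p x 0 = soloValue M 0 h n ζ p x := by
  induction h generalizing n ζ p x with
  | zero => rw [gameValue, soloValue]
  | succ h ih =>
    rcases n with _ | n
    · simp only [gameValue, soloValue, ih]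
    · simp [gameValue]

theorem gameValue_eq_soloValue_one (h m : ℕ) (ζ : Profile) (p x : ℝ) :
    gameValue M Γ β h 0 m ζ p x 1 = soloValue M 1 h m ζ p x := by
  induction h generalizing m ζ p x with
  | zero => rw [gameValue, soloValue]
  | succ h ih =>
    rcases m with _ | m
    · simp only [gameValue, soloValue, ih]
    · simp [gameValue]

/-! ### The incentives in a single round -/

/-- The payoff of player `i` from a round with action profile `act`, the values of the cascade
being obtained afterwards. -/
noncomputable def roundValue (h n m : ℕ) (ζ : Profile) (p x : ℝ) (i : Fin 2) (act : Profile) : ℝ :=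
  if act = pass then M.hold i ζ p x (fun p' x' => gameValue M Γ β h n m ζ p' x' i)
  else gameValue M Γ β (h + 1) (n - (act 0).toNat) (m - (act 1).toNat) (toggle ζ act) p x i
    - M.switchCost i ζ act

/-- `roundValue` makes sense for all budgets, exhausted ones included, and so treats every round
alike. For two positive budgets it is the very game to which `Γ` is applied, which makes the
equilibrium inequality available. -/
theorem roundValue_eq_roundGame (h n m : ℕ) (ζ : Profile) (p x : ℝ) (i : Fin 2) (act : Profile) :
    roundValue Γ β h (n + 1) (m + 1) ζ p x i act =
      roundGame M (gameValue M Γ β h (n + 1) (m + 1)) (gameValue M Γ β (h + 1) (n + 1) m)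
        (gameValue M Γ β (h + 1) n (m + 1)) (gameValue M Γ β (h + 1) n m) ζ p x act i := by
  unfold roundValue roundGame
  rcases profile_cases act with h | h | h | h <;> subst h <;> simp [pass_eq]

theorem roundValue_pass (h n m : ℕ) (ζ : Profile) (p x : ℝ) (i : Fin 2) :
    roundValue Γ β h n m ζ p x i ![false, false] =
      M.hold i ζ p x (fun p' x' => gameValue M Γ β h n m ζ p' x' i) := by
  rw [roundValue, if_pos pass_eq.symm]

theorem roundValue_zero (h n m : ℕ) (ζ : Profile) (p x : ℝ) (i : Fin 2) :
    roundValue Γ β h (n + 1) m ζ p x i ![true, false] =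
      gameValue M Γ β (h + 1) n m (toggle ζ (only 0)) p x i - M.switchCost i ζ (only 0) := by
  rw [roundValue, if_neg (by decide), only_zero]
  simp

theorem roundValue_one (h n m : ℕ) (ζ : Profile) (p x : ℝ) (i : Fin 2) :
    roundValue Γ β h n (m + 1) ζ p x i ![false, true] =
      gameValue M Γ β (h + 1) n m (toggle ζ (only 1)) p x i - M.switchCost i ζ (only 1) := by
  rw [roundValue, if_neg (by decide), only_one]
  simp

theorem switchCost_only_self (i : Fin 2) (ζ : Profile) :
    M.switchCost i ζ (only i) = M.K i (ζ i) (!ζ i) := by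
  simp [Market.switchCost, only]

theorem switchCost_only_of_ne {i j : Fin 2} (hij : i ≠ j) (ζ : Profile) :
    M.switchCost i ζ (only j) = 0 := by
  simp [Market.switchCost, only, hij]

theorem sum_device_zero_zero (t : ℕ) (ζ : Profile) (p x : ℝ) (F : Profile → ℝ) :
    ∑ a, device M Γ β t 0 0 ζ p x a * F a = F ![false, false] := by
  rw [sum_profile]; simp only [device, pass_eq]; simp

theorem sum_device_succ_zero (t n : ℕ) (ζ : Profile) (p x : ℝ) (F : Profile → ℝ) :
    ∑ a, device M Γ β t (n + 1) 0 ζ p x a * F a =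
      (1 - β.prob 0 (n + 1) t ζ (p, x)) * F ![false, false]
        + β.prob 0 (n + 1) t ζ (p, x) * F ![true, false] := by
  rw [sum_profile]; simp only [device, pass_eq, only_zero]; simp

theorem sum_device_zero_succ (t m : ℕ) (ζ : Profile) (p x : ℝ) (F : Profile → ℝ) :
    ∑ a, device M Γ β t 0 (m + 1) ζ p x a * F a =
      (1 - β.prob 1 (m + 1) t ζ (p, x)) * F ![false, false]
        + β.prob 1 (m + 1) t ζ (p, x) * F ![false, true] := by
  rw [sum_profile]; simp only [device, pass_eq, only_one]; simp

variable {h t : ℕ} (ht : t + (h + 1) = M.T) (n m : ℕ) (ζ : Profile) (p x : ℝ) (i : Fin 2)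

include ht in
-- The Bellman equation under obedience. It holds by definition except for a player who alone has
-- switches left: her value is defined as a maximum, and `β.optimal` says that the mixture attains
-- it. The passive player pays no cost when the other one switches.
theorem sum_device_mul_roundValue :
    ∑ a, device M Γ β t n m ζ p x a * roundValue Γ β h n m ζ p x i a =
      gameValue M Γ β (h + 1) n m ζ p x i := by
  have e1 : M.T - (h + 1) = t := by omega
  have e2 : M.T - (t + 1) = h := by omega
  have e3 : M.T - t = h + 1 := by omega
  rcases n with _ | n <;> rcases m with _ | m
  · rw [sum_device_zero_zero, roundValue_pass]
    simp only [gameValue]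
  · rw [sum_device_zero_succ, roundValue_pass, roundValue_one]
    fin_cases i
    · rw [switchCost_only_of_ne (by decide)]
      simp [gameValue, e1]
    · have := β.optimal 1 m t ζ p x (by omega)
      rw [e2, e3] at this
      simp only [Fin.mk_one, gameValue_eq_soloValue_one, switchCost_only_self]
      exact this
  · rw [sum_device_succ_zero, roundValue_pass, roundValue_zero]
    fin_cases i
    · have := β.optimal 0 n t ζ p x (by omega)
      rw [e2, e3] at this
      simp only [Fin.zero_eta, gameValue_eq_soloValue_zero, switchCost_only_self]
      exact this
    · rw [switchCost_only_of_ne (by decide)]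
      simp [gameValue, e1]
  · simp only [roundValue_eq_roundGame, device, e2, e3]
    simp only [gameValue, e1]

include ht in
-- The incentive inequality of one round. With both budgets positive it is the CEP condition. A
-- player who alone has switches left mixes between the two arguments of the maximum that is her
-- value. A player without switches left receives only the signal `false`, so `d false = false`
-- makes her reaction coincide with obedience and `d true` is irrelevant.
theorem sum_device_mul_roundValue_update_le {d : Bool → Bool}
    (hd : (![n, m] : Fin 2 → ℕ) i = 0 → d false = false) :
    ∑ a, device M Γ β t n m ζ p x a *
        roundValue Γ β h n m ζ p x i (Function.update a i (d (a i))) ≤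
      gameValue M Γ β (h + 1) n m ζ p x i := by
  have e2 : M.T - (t + 1) = h := by omega
  have e3 : M.T - t = h + 1 := by omega
  have u00 : ∀ b : Bool, Function.update ![b, false] 0 false = ![false, false] := by decide
  have u01 : ∀ b : Bool, Function.update ![b, false] 0 true = ![true, false] := by decide
  have u10 : ∀ b c : Bool, Function.update ![b, c] 1 false = ![b, false] := by decide
  have u11 : ∀ b c : Bool, Function.update ![b, c] 1 true = ![b, true] := by decide
  have v00 : ∀ b c : Bool, Function.update ![b, c] 0 false = ![false, c] := by decide
  have avg : ∀ {q a b c : ℝ}, q ∈ Set.Icc (0 : ℝ) 1 → a ≤ c → b ≤ c →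
      (1 - q) * a + q * b ≤ c := by
    intro q a b c hq ha hb
    have h1 := mul_le_mul_of_nonneg_left ha (sub_nonneg.2 hq.2)
    have h2 := mul_le_mul_of_nonneg_left hb hq.1
    linarith
  rw [← sum_device_mul_roundValue Γ β ht]
  rcases n with _ | n <;> rcases m with _ | m
  · have hd' : d false = false := hd (by fin_cases i <;> rfl)
    rw [sum_device_zero_zero, sum_device_zero_zero]
    fin_cases i <;> simp [hd', u00, u10]
  · rw [sum_device_zero_succ]
    fin_cases i
    · have hd' : d false = false := hd rfl
      rw [sum_device_zero_succ]
      simp [hd', v00]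
    · rw [sum_device_mul_roundValue Γ β ht]
      have hv : ∀ b, roundValue Γ β h 0 (m + 1) ζ p x 1 ![false, b] ≤
          gameValue M Γ β (h + 1) 0 (m + 1) ζ p x 1 := by
        intro b
        rw [gameValue_eq_soloValue_one, soloValue]
        cases b
        · rw [roundValue_pass]
          simp only [gameValue_eq_soloValue_one]
          exact le_max_left _ _
        · rw [roundValue_one, switchCost_only_self, gameValue_eq_soloValue_one]
          exact le_max_right _ _
      have hu : ∀ b c : Bool, Function.update ![false, b] 1 c = ![false, c] := by decide
      simp only [Fin.mk_one, hu]
      exact avg (β.prob_mem _ _ _ _ _) (hv _) (hv _)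
  · rw [sum_device_succ_zero]
    fin_cases i
    · rw [sum_device_mul_roundValue Γ β ht]
      have hv : ∀ b, roundValue Γ β h (n + 1) 0 ζ p x 0 ![b, false] ≤
          gameValue M Γ β (h + 1) (n + 1) 0 ζ p x 0 := by
        intro b
        rw [gameValue_eq_soloValue_zero, soloValue]
        cases b
        · rw [roundValue_pass]
          simp only [gameValue_eq_soloValue_zero]
          exact le_max_left _ _
        · rw [roundValue_zero, switchCost_only_self, gameValue_eq_soloValue_zero]
          exact le_max_right _ _
      have hu : ∀ b c : Bool, Function.update ![b, false] 0 c = ![c, false] := by decide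
      simp only [Fin.zero_eta, hu]
      exact avg (β.prob_mem _ _ _ _ _) (hv _) (hv _)
    · have hd' : d false = false := hd rfl
      rw [sum_device_succ_zero]
      simp [hd', u10]
  · simp only [roundValue_eq_roundGame, device, e2, e3]
    exact (Γ.isCEP _ _ _).2.2 i d

theorem device_eq_zero_of_budget {j : Fin 2} (hj : (![n, m] : Fin 2 → ℕ) j = 0) {a : Profile}
    (ha : a j = true) : device M Γ β t n m ζ p x a = 0 := by
  have hp : a ≠ pass := by rintro rfl; simp [pass] at ha
  have ho : ∀ k, k ≠ j → a ≠ only k := by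
    rintro k hk rfl; simp [only] at ha; exact hk ha.symm
  fin_cases j
  · have hn : n = 0 := hj
    subst hn
    rcases m with _ | m <;> simp [device, hp, ho 1 (by decide)]
  · have hm : m = 0 := hj
    subst hm
    rcases n with _ | n <;> simp [device, hp, ho 0 (by decide)]

end Values

/-! ### The draw of the signals -/

theorem measurable_draw : Measurable (fun z : Lottery × ℝ => draw z.1 z.2) := by
  unfold draw
  refine Measurable.ite ?_ measurable_const (Measurable.ite ?_ measurable_const
    (Measurable.ite ?_ measurable_const measurable_const))
  all_goals
    refine measurableSet_lt measurable_snd ?_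
    fun_prop

/-- The cutoffs split the unit interval into four intervals whose lengths are the weights of `γ`.
Endpoints are null sets, so it suffices to know the draw on the open intervals. -/
theorem integral_draw {γ : Lottery} (h0 : ∀ a, 0 ≤ γ a) (h1 : ∑ a, γ a = 1) (F : Profile → ℝ) :
    ∫ y in Set.Icc (0 : ℝ) 1, F (draw γ y) = ∑ a, γ a * F a := by
  rw [sum_profile] at h1 ⊢
  have a0 := h0 ![true, true]
  have a1 := h0 ![true, false]
  have a2 := h0 ![false, true]
  have a3 := h0 ![false, false]
  set c1 := γ ![true, true]
  set c2 := γ ![true, true] + γ ![true, false] with hc2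
  set c3 := γ ![true, true] + γ ![true, false] + γ ![false, true] with hc3
  have key : ∀ (a b : ℝ) (s : Profile), a ≤ b → (∀ y ∈ Set.Ioo a b, draw γ y = s) →
      IntervalIntegrable (fun y => F (draw γ y)) volume a b ∧
      ∫ y in a..b, F (draw γ y) = (b - a) * F s := by
    intro a b s hab hs
    have hae : ∀ᵐ y ∂volume, y ∈ Set.uIoc a b → F s = F (draw γ y) := by
      have : ∀ᵐ y ∂(volume : Measure ℝ), y ≠ b := by simp [ae_iff, measure_singleton]
      filter_upwards [this] with y hy hm
      rw [Set.uIoc_of_le hab] at hm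
      rw [hs y ⟨hm.1, lt_of_le_of_ne hm.2 hy⟩]
    constructor
    · exact (intervalIntegrable_const (c := F s)).congr_ae
        ((ae_restrict_iff' measurableSet_uIoc).2 hae)
    · rw [← intervalIntegral.integral_congr_ae hae]
      simp
  have k1 := key 0 c1 ![true, true] a0 (fun y hy => by simp [draw, c1, hy.2])
  have k2 := key c1 c2 ![true, false] (by linarith) (fun y hy => by
    have := hy.1; have := hy.2
    unfold draw; rw [if_neg (by linarith), if_pos (by linarith)])
  have k3 := key c2 c3 ![false, true] (by linarith) (fun y hy => by
    have := hy.1; have := hy.2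
    unfold draw; rw [if_neg (by linarith), if_neg (by linarith), if_pos (by linarith)])
  have k4 := key c3 1 ![false, false] (by linarith) (fun y hy => by
    have := hy.1; have := hy.2
    unfold draw; rw [if_neg (by linarith), if_neg (by linarith), if_neg (by linarith)])
  rw [integral_Icc_eq_integral_Ioc, ← intervalIntegral.integral_of_le zero_le_one,
    ← intervalIntegral.integral_add_adjacent_intervals k1.1 ((k2.1.trans k3.1).trans k4.1),
    ← intervalIntegral.integral_add_adjacent_intervals (k2.1.trans k3.1) k4.1,
    ← intervalIntegral.integral_add_adjacent_intervals k2.1 k3.1, k1.2, k2.2, k3.2, k4.2]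
  have e : (1 : ℝ) - c3 = γ ![false, false] := by linarith
  rw [e, hc2, hc3]
  ring

/-- Profiles of weight zero correspond to empty intervals, because the cutoffs are strict. Only
negative `y` could produce them, which is why obedience respects the budget almost surely rather
than surely. -/
theorem draw_apply_eq_false {γ : Lottery} {j : Fin 2}
    (hγ : ∀ a : Profile, a j = true → γ a = 0) {y : ℝ} (hy : 0 ≤ y) : draw γ y j = false := by
  unfold draw
  fin_cases j
  · have h1 : γ ![true, true] = 0 := hγ _ rfl
    have h2 : γ ![true, false] = 0 := hγ _ rfl
    rw [if_neg (by linarith), if_neg (by linarith)]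
    split_ifs <;> rfl
  · have h1 : γ ![true, true] = 0 := hγ _ rfl
    have h2 : γ ![false, true] = 0 := hγ _ rfl
    rw [if_neg (by linarith)]
    by_cases h : y < γ ![true, true] + γ ![true, false]
    · rw [if_pos h]; rfl
    · rw [if_neg h, if_neg (by linarith)]; rfl

/-! ### Measurability of the play -/

/-- Regimes and numbers of switches take countably many values, so measurability in the prices has
to be checked only with these data fixed. -/
theorem measurable_apply_of_countable {α β γ ι : Type*} [MeasurableSpace α] [MeasurableSpace β]
    [MeasurableSpace γ] [MeasurableSpace ι] [Countable ι] [MeasurableSingletonClass ι]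
    {f : ι → β → γ} (hf : ∀ i, Measurable (f i)) {g : α → ι} {k : α → β} (hg : Measurable g)
    (hk : Measurable k) : Measurable (fun a => f (g a) (k a)) :=
  (measurable_from_prod_countable_right (f := fun z : ι × β => f z.1 z.2) hf).comp (hg.prodMk hk)

/-- A position as a tuple. -/
def Position.toProd (S : Position) : ℝ × ℝ × Profile × (Fin 2 → ℕ) × Bool :=
  (S.p, S.x, S.reg, S.used, S.isOpen)

instance : MeasurableSpace Position := MeasurableSpace.comap Position.toProd inferInstance

theorem Position.measurable_toProd : Measurable Position.toProd := comap_measurable _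

theorem measurable_position {α : Type*} [MeasurableSpace α] {f : α → Position}
    (hp : Measurable fun a => (f a).p) (hx : Measurable fun a => (f a).x)
    (hr : Measurable fun a => (f a).reg) (hu : Measurable fun a => (f a).used)
    (ho : Measurable fun a => (f a).isOpen) : Measurable f :=
  measurable_comap_iff.2 (hp.prodMk (hx.prodMk (hr.prodMk (hu.prodMk ho))))

theorem Position.measurable_p : Measurable Position.p := measurable_toProd.fst

theorem Position.measurable_x : Measurable Position.x := measurable_toProd.snd.fst

theorem Position.measurable_reg : Measurable Position.reg := measurable_toProd.snd.snd.fst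

theorem Position.measurable_used : Measurable Position.used := measurable_toProd.snd.snd.snd.fst

theorem Position.measurable_isOpen : Measurable Position.isOpen :=
  measurable_toProd.snd.snd.snd.snd

/-! ### Integrating out an innovation that is independent of the past -/

/-- The joint law of `U` and `V` is a product, so Tonelli's theorem integrates over `V` with `U`
frozen. This nonnegative version comes first because it serves to prove finiteness of moments along
the play. -/
theorem lintegral_comp_of_indep {Ω α β : Type*} {m mΩ : MeasurableSpace Ω} [MeasurableSpace α]
    [MeasurableSpace β] {Pr : Measure Ω} [IsProbabilityMeasure Pr] (hm : m ≤ mΩ) {U : Ω → α}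
    {V : Ω → β} (hU : Measurable[m] U) (hV : Measurable V)
    (hind : Indep m (MeasurableSpace.comap V inferInstance) Pr) {F : α → β → ℝ≥0∞}
    (hF : Measurable (fun z : α × β => F z.1 z.2)) :
    ∫⁻ ω, F (U ω) (V ω) ∂Pr = ∫⁻ ω, ∫⁻ y, F (U ω) y ∂(Pr.map V) ∂Pr := by
  have hU' : Measurable U := hU.mono hm le_rfl
  have hUV : IndepFun U V Pr := indep_of_indep_of_le_left hind hU.comap_le
  have hmap := (indepFun_iff_map_prod_eq_prod_map_map hU'.aemeasurable hV.aemeasurable).1 hUV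
  have : IsProbabilityMeasure (Pr.map V) := Measure.isProbabilityMeasure_map hV.aemeasurable
  calc ∫⁻ ω, F (U ω) (V ω) ∂Pr = ∫⁻ z, F z.1 z.2 ∂(Pr.map fun ω => (U ω, V ω)) :=
        (lintegral_map hF (hU'.prodMk hV)).symm
    _ = ∫⁻ u, ∫⁻ y, F u y ∂(Pr.map V) ∂(Pr.map U) := by
        rw [hmap, lintegral_prod _ hF.aemeasurable]
    _ = _ := lintegral_map (hF.lintegral_prod_right' (f := fun z : α × β => F z.1 z.2)) hU'

theorem integral_comp_of_indep {Ω α β : Type*} {m mΩ : MeasurableSpace Ω} [MeasurableSpace α]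
    [MeasurableSpace β] {Pr : Measure Ω} [IsProbabilityMeasure Pr] (hm : m ≤ mΩ) {U : Ω → α}
    {V : Ω → β} (hU : Measurable[m] U) (hV : Measurable V)
    (hind : Indep m (MeasurableSpace.comap V inferInstance) Pr) {F : α → β → ℝ}
    (hF : Measurable (fun z : α × β => F z.1 z.2))
    (hint : Integrable (fun ω => F (U ω) (V ω)) Pr) :
    Integrable (fun ω => ∫ y, F (U ω) y ∂(Pr.map V)) Pr ∧
      ∫ ω, F (U ω) (V ω) ∂Pr = ∫ ω, ∫ y, F (U ω) y ∂(Pr.map V) ∂Pr := by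
  have hU' : Measurable U := hU.mono hm le_rfl
  have hUV : IndepFun U V Pr := indep_of_indep_of_le_left hind hU.comap_le
  have hmap := (indepFun_iff_map_prod_eq_prod_map_map hU'.aemeasurable hV.aemeasurable).1 hUV
  have : IsProbabilityMeasure (Pr.map V) := Measure.isProbabilityMeasure_map hV.aemeasurable
  have hint' : Integrable (fun z : α × β => F z.1 z.2) ((Pr.map U).prod (Pr.map V)) := by
    rw [← hmap]
    exact (integrable_map_measure hF.aestronglyMeasurable (hU'.prodMk hV).aemeasurable).2 hint
  refine ⟨hint'.integral_prod_left.comp_measurable hU', ?_⟩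
  calc ∫ ω, F (U ω) (V ω) ∂Pr = ∫ z, F z.1 z.2 ∂(Pr.map fun ω => (U ω, V ω)) :=
        (integral_map (hU'.prodMk hV).aemeasurable hF.aestronglyMeasurable).symm
    _ = ∫ u, ∫ y, F u y ∂(Pr.map V) ∂(Pr.map U) := by
        rw [hmap, integral_prod _ hint']
    _ = _ := integral_map hU'.aemeasurable
        (hF.stronglyMeasurable.integral_prod_right'
          (f := fun z : α × β => F z.1 z.2)).aestronglyMeasurable

/-! ### Rounds and stages as measurable maps -/

namespace Setup

variable (A : Setup)

/-- The lottery used at stage `t` in position `S`. -/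
noncomputable def lottery (t : ℕ) (S : Position) : Lottery :=
  device A.M A.Γ A.β t (A.n - S.used 0) (A.m - S.used 1) S.reg S.p S.x

/-- The outcome of a round at stage `t` in position `S`, as a function of the reactions `d` of the
players to their signals and of the variate `y` used by the third party. -/
noncomputable def roundStep (t : ℕ) (d : Fin 2 → Bool → Bool) (S : Position) (y : ℝ) : Position :=
  { p := S.p
    x := S.x
    reg := toggle S.reg (fun i => S.isOpen && d i (draw (A.lottery t S) y i))
    used := fun i => S.used i + (S.isOpen && d i (draw (A.lottery t S) y i)).toNat
    isOpen := (S.isOpen && d 0 (draw (A.lottery t S) y 0))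
      || (S.isOpen && d 1 (draw (A.lottery t S) y 1)) }

/-- The passage to the next stage. -/
noncomputable def stageStep (S : Position) (e : ℝ × ℝ) : Position :=
  { p := A.M.G S.p e.1
    x := A.M.nextX S.reg S.x e
    reg := S.reg
    used := S.used
    isOpen := true }

theorem measurable_lottery (t : ℕ) : Measurable (A.lottery t) := by
  refine measurable_pi_iff.2 fun a => ?_
  have h := measurable_apply_of_countable
    (f := fun (k : ℕ × ℕ × Profile) (y : ℝ × ℝ) =>
      device A.M A.Γ A.β t k.1 k.2.1 k.2.2 y.1 y.2 a)
    (fun k => measurable_device _ _ _ _ _ _ _)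
    (g := fun S : Position => (A.n - S.used 0, A.m - S.used 1, S.reg))
    (k := fun S : Position => (S.p, S.x))
    (((measurable_of_countable (fun u : Fin 2 → ℕ => A.n - u 0)).comp
      Position.measurable_used).prodMk
      (((measurable_of_countable (fun u : Fin 2 → ℕ => A.m - u 1)).comp
        Position.measurable_used).prodMk Position.measurable_reg))
    (Position.measurable_p.prodMk Position.measurable_x)
  exact h

theorem measurable_roundStep (t : ℕ) : Measurable
    (fun z : (Position × (Fin 2 → Bool → Bool)) × ℝ => A.roundStep t z.1.2 z.1.1 z.2) := by
  have hS : Measurable (fun z : (Position × (Fin 2 → Bool → Bool)) × ℝ => z.1.1) := by fun_prop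
  have hd : Measurable (fun z : (Position × (Fin 2 → Bool → Bool)) × ℝ => z.1.2) := by fun_prop
  have hμ : Measurable (fun z : (Position × (Fin 2 → Bool → Bool)) × ℝ =>
      draw (A.lottery t z.1.1) z.2) :=
    measurable_draw.comp (((A.measurable_lottery t).comp hS).prodMk measurable_snd)
  have hr := Position.measurable_reg.comp hS
  have hu := Position.measurable_used.comp hS
  have ho := Position.measurable_isOpen.comp hS
  -- Once the signals are drawn, the new regimes, counts and flag depend only on data in a countable
  -- type.
  have hi : Measurable (fun z : (Position × (Fin 2 → Bool → Bool)) × ℝ =>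
      (z.1.1.reg, z.1.1.used, z.1.1.isOpen, z.1.2, draw (A.lottery t z.1.1) z.2)) :=
    hr.prodMk (hu.prodMk (ho.prodMk (hd.prodMk hμ)))
  have hp := Position.measurable_p.comp hS
  have hx := Position.measurable_x.comp hS
  refine measurable_position hp hx ?_ ?_ ?_
  · exact (measurable_of_countable (fun k : Profile × (Fin 2 → ℕ) × Bool ×
      (Fin 2 → Bool → Bool) × Profile =>
        toggle k.1 (fun i => k.2.2.1 && k.2.2.2.1 i (k.2.2.2.2 i)))).comp hi
  · exact (measurable_of_countable (fun k : Profile × (Fin 2 → ℕ) × Bool ×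
      (Fin 2 → Bool → Bool) × Profile =>
        (fun i => k.2.1 i + (k.2.2.1 && k.2.2.2.1 i (k.2.2.2.2 i)).toNat : Fin 2 → ℕ))).comp hi
  · exact (measurable_of_countable (fun k : Profile × (Fin 2 → ℕ) × Bool ×
      (Fin 2 → Bool → Bool) × Profile =>
        ((k.2.2.1 && k.2.2.2.1 0 (k.2.2.2.2 0)) || (k.2.2.1 && k.2.2.2.1 1 (k.2.2.2.2 1))))).comp hi

theorem measurable_stageStep :
    Measurable (fun z : Position × (ℝ × ℝ) => A.stageStep z.1 z.2) := by
  have hr : Measurable (fun z : Position × (ℝ × ℝ) => z.1.reg) :=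
    Position.measurable_reg.comp measurable_fst
  have hu : Measurable (fun z : Position × (ℝ × ℝ) => z.1.used) :=
    Position.measurable_used.comp measurable_fst
  refine measurable_position ?_ ?_ hr hu measurable_const
  · exact A.M.measurable_G.comp
      ((Position.measurable_p.comp measurable_fst).prodMk measurable_snd.fst)
  · exact measurable_apply_of_countable
      (f := fun (u : Profile) (y : ℝ × (ℝ × ℝ)) => A.M.nextX u y.1 y.2)
      (fun u => A.M.measurable_nextX u) (Position.measurable_reg.comp measurable_fst)
      ((Position.measurable_x.comp measurable_fst).prodMk measurable_snd)

theorem measurable_roundStep_comp {α : Type*} {mα : MeasurableSpace α} (t : ℕ)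
    {d : α → Fin 2 → Bool → Bool} {S : α → Position} {y : α → ℝ}
    (hd : ∀ i μ, Measurable fun a => d a i μ) (hS : Measurable S) (hy : Measurable y) :
    Measurable (fun a => A.roundStep t (d a) (S a) (y a)) := by
  have hd' : Measurable d := measurable_pi_iff.2 fun i => measurable_pi_iff.2 fun μ => hd i μ
  exact (A.measurable_roundStep t).comp ((hS.prodMk hd').prodMk hy)

theorem measurable_stageStep_comp {α : Type*} {mα : MeasurableSpace α} {S : α → Position}
    {e : α → ℝ × ℝ} (hS : Measurable S) (he : Measurable e) :
    Measurable (fun a => A.stageStep (S a) (e a)) :=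
  A.measurable_stageStep.comp (hS.prodMk he)

variable {Ω : Type*} [mΩ : MeasurableSpace Ω] {Pr : Measure Ω} (E : Environment Pr)
  (D : Fin 2 → Strategy Ω)

theorem position_zero (ω : Ω) (q : ℕ) : A.position E D ω q 0 = A.start E D ω q := rfl

theorem position_succ (ω : Ω) (q r : ℕ) : A.position E D ω q (r + 1) =
    A.roundStep (A.s + q) (fun i => D i (A.s + q) r ω) (A.position E D ω q r)
      (E.η (A.s + q) r ω) := rfl

theorem start_succ (ω : Ω) (q : ℕ) : A.start E D ω (q + 1) =
    A.stageStep (A.position E D ω q (A.n + A.m)) (E.ε (A.s + q) ω) := rfl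

variable {E D}

theorem measurable_position_of_start (hD : ∀ i, (D i).IsAdapted E) (q : ℕ)
    (h : Measurable[E.𝓖 (toLex (A.s + q, 0))] (fun ω => A.start E D ω q)) (r : ℕ) :
    Measurable[E.𝓖 (toLex (A.s + q, r))] (fun ω => A.position E D ω q r) := by
  induction r with
  | zero => exact h
  | succ r ih =>
    have hle : E.𝓖 (toLex (A.s + q, r)) ≤ E.𝓖 (toLex (A.s + q, r + 1)) :=
      E.𝓖.mono (by rw [Prod.Lex.toLex_le_toLex]; right; simp)
    simp only [position_succ]
    exact A.measurable_roundStep_comp (A.s + q)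
      (fun i μ => (hD i (A.s + q) r μ).mono hle le_rfl) (ih.mono hle le_rfl)
      (E.measurable_η (A.s + q) r)

theorem measurable_start_adapted (hD : ∀ i, (D i).IsAdapted E) (q : ℕ) :
    Measurable[E.𝓖 (toLex (A.s + q, 0))] (fun ω => A.start E D ω q) := by
  induction q with
  | zero => exact measurable_const
  | succ q ih =>
    have h := A.measurable_position_of_start hD q ih (A.n + A.m)
    -- In lexicographic time, round `0` of a stage comes after every round of the preceding stage.
    have hle : E.𝓖 (toLex (A.s + q, A.n + A.m)) ≤ E.𝓖 (toLex (A.s + (q + 1), 0)) :=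
      E.𝓖.mono (by rw [Prod.Lex.toLex_le_toLex]; left; show A.s + q < A.s + (q + 1); omega)
    simp only [start_succ]
    exact A.measurable_stageStep_comp (h.mono hle le_rfl) (E.measurable_ε (A.s + q))

theorem measurable_position_adapted (hD : ∀ i, (D i).IsAdapted E) (q r : ℕ) :
    Measurable[E.𝓖 (toLex (A.s + q, r))] (fun ω => A.position E D ω q r) :=
  A.measurable_position_of_start hD q (A.measurable_start_adapted hD q) r

theorem measurable_position_ambient (hD : ∀ i, (D i).IsAdapted E) (q r : ℕ) :
    Measurable (fun ω => A.position E D ω q r) :=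
  (A.measurable_position_adapted hD q r).mono (E.𝓖.le _) le_rfl

theorem measurable_start_ambient (hD : ∀ i, (D i).IsAdapted E) (q : ℕ) :
    Measurable (fun ω => A.start E D ω q) :=
  A.measurable_position_ambient hD q 0

theorem measurable_ε' (E : Environment Pr) (t : ℕ) : Measurable (E.ε t) :=
  (E.measurable_ε t).mono (E.𝓖.le _) le_rfl

theorem measurable_η' (E : Environment Pr) (t r : ℕ) : Measurable (E.η t r) :=
  (E.measurable_η t r).mono (E.𝓖.le _) le_rfl

/-! ### Integrability along the play -/

theorem position_p (ω : Ω) (q r : ℕ) : (A.position E D ω q r).p = (A.start E D ω q).p := by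
  induction r with
  | zero => rfl
  | succ r ih => rw [← ih]; rfl

theorem position_x (ω : Ω) (q r : ℕ) : (A.position E D ω q r).x = (A.start E D ω q).x := by
  induction r with
  | zero => rfl
  | succ r ih => rw [← ih]; rfl

variable {A} in
theorem start_x_pos (hx : 0 < A.x) (ω : Ω) (q : ℕ) : 0 < (A.start E D ω q).x := by
  induction q with
  | zero => exact hx
  | succ q ih =>
    rw [start_succ]
    refine A.M.nextX_pos _ ?_ _
    rwa [position_x]

variable [IsProbabilityMeasure Pr]

/-- Going one stage back raises `N` to `N + 1`, so the induction on `q` must treat all `N` together;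
at the initial stage the integrand is a finite constant. -/
theorem lintegral_scale_start_lt_top (hx : 0 < A.x) (hD : ∀ i, (D i).IsAdapted E) (q N : ℕ) :
    ∫⁻ ω, A.M.scale N (A.start E D ω q).p (A.start E D ω q).x ∂Pr < ⊤ := by
  induction q generalizing N with
  | zero => simpa [start] using A.M.scale_lt_top N A.p A.x
  | succ q ih =>
    obtain ⟨C, hC⟩ := A.M.lintegral_scale_next N
    have hF : Measurable (fun z : Position × (ℝ × ℝ) =>
        A.M.scale N (A.stageStep z.1 z.2).p (A.stageStep z.1 z.2).x) :=
      (A.M.measurable_scale N).comp ((Position.measurable_p.comp A.measurable_stageStep).prodMk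
        (Position.measurable_x.comp A.measurable_stageStep))
    simp only [start_succ]
    rw [lintegral_comp_of_indep (E.𝓖.le _)
      (A.measurable_position_adapted hD q (A.n + A.m)) (measurable_ε' E (A.s + q))
      (E.indep_ε (A.s + q) (A.n + A.m))
      (F := fun S e => A.M.scale N (A.stageStep S e).p (A.stageStep S e).x) hF, E.law_ε]
    calc _ ≤ ∫⁻ ω, C * A.M.scale (N + 1) (A.start E D ω q).p (A.start E D ω q).x ∂Pr := by
          refine lintegral_mono fun ω => ?_
          rw [← A.position_p ω q (A.n + A.m), ← A.position_x ω q (A.n + A.m)]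
          exact hC _ _ _ (by rw [position_x]; exact start_x_pos hx ω q)
      _ = C * ∫⁻ ω, A.M.scale (N + 1) (A.start E D ω q).p (A.start E D ω q).x ∂Pr :=
          lintegral_const_mul' _ _ ENNReal.coe_ne_top
      _ < ⊤ := ENNReal.mul_lt_top ENNReal.coe_lt_top (ih (N + 1))

/-- The random index takes values in a finite set, so the sum of the absolute values over that set
dominates. -/
theorem integrable_tame_apply (hx : 0 < A.x) (hD : ∀ i, (D i).IsAdapted E) (q : ℕ) {ι : Type*}
    [MeasurableSpace ι] [Countable ι] [MeasurableSingletonClass ι] {f : ι → ℝ → ℝ → ℝ}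
    (hf : ∀ k, A.M.Tame (f k)) (s : Finset ι) {g : Ω → ι} (hg : Measurable g)
    (hs : ∀ ω, g ω ∈ s) :
    Integrable (fun ω => f (g ω) (A.start E D ω q).p (A.start E D ω q).x) Pr := by
  have hpx : Measurable (fun ω => ((A.start E D ω q).p, (A.start E D ω q).x)) :=
    (Position.measurable_p.comp (A.measurable_start_ambient hD q)).prodMk
      (Position.measurable_x.comp (A.measurable_start_ambient hD q))
  have h1 : ∀ k, Integrable (fun ω => f k (A.start E D ω q).p (A.start E D ω q).x) Pr := by
    intro k
    obtain ⟨hm, C, N, hb⟩ := hf k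
    refine ⟨(hm.comp hpx).aestronglyMeasurable, ?_⟩
    calc ∫⁻ ω, ‖f k (A.start E D ω q).p (A.start E D ω q).x‖ₑ ∂Pr
        ≤ ∫⁻ ω, C * A.M.scale N (A.start E D ω q).p (A.start E D ω q).x ∂Pr :=
          lintegral_mono fun ω => hb _ _ (start_x_pos hx ω q)
      _ = C * ∫⁻ ω, A.M.scale N (A.start E D ω q).p (A.start E D ω q).x ∂Pr :=
          lintegral_const_mul' _ _ ENNReal.coe_ne_top
      _ < ⊤ := ENNReal.mul_lt_top ENNReal.coe_lt_top
          (A.lintegral_scale_start_lt_top hx hD q N)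
  refine Integrable.mono' (g := fun ω => ∑ k ∈ s, |f k (A.start E D ω q).p (A.start E D ω q).x|)
    (integrable_finsetSum _ fun k _ => (h1 k).abs) ?_ (Filter.Eventually.of_forall fun ω => ?_)
  · exact (measurable_apply_of_countable (f := fun k (y : ℝ × ℝ) => f k y.1 y.2)
      (fun k => (hf k).1) hg hpx).aestronglyMeasurable
  · rw [Real.norm_eq_abs]
    exact Finset.single_le_sum
      (f := fun k => |f k (A.start E D ω q).p (A.start E D ω q).x|) (fun _ _ => abs_nonneg _) (hs ω)

end Setup

namespace Setup

variable (A : Setup)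

/-! ### The value of a position -/

/-- The value of the cascade for player `i` at the beginning of a stage from which `h` stages
remain. -/
noncomputable def cascadeValue (h : ℕ) (i : Fin 2) (S : Position) : ℝ :=
  gameValue A.M A.Γ A.β h (A.n - S.used 0) (A.m - S.used 1) S.reg S.p S.x i

/-- The value for player `i` of a stage in which nobody switches any more. -/
noncomputable def holdValue (h : ℕ) (i : Fin 2) (S : Position) : ℝ :=
  A.M.hold i S.reg S.p S.x
    (fun p' x' => gameValue A.M A.Γ A.β h (A.n - S.used 0) (A.m - S.used 1) S.reg p' x' i)

/-- The value for player `i` before a round of a stage after which `h` stages remain. -/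
noncomputable def potential (h : ℕ) (i : Fin 2) (S : Position) : ℝ :=
  if S.isOpen then A.cascadeValue (h + 1) i S else A.holdValue h i S

/-- The cost of the change of regime of player `i` between two positions. -/
def cost (i : Fin 2) (S S' : Position) : ℝ := A.M.K i (S.reg i) (S'.reg i)

/-- The reactions to the signals when player `i` reacts by `d` and the other player obeys. -/
def reaction (i : Fin 2) (d : Bool → Bool) : Fin 2 → Bool → Bool :=
  Function.update (fun _ μ => μ) i d

theorem reaction_apply (i : Fin 2) (d : Bool → Bool) (a : Profile) :
    (fun k => reaction i d k (a k)) = Function.update a i (d (a i)) := by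
  funext k
  by_cases hk : k = i
  · subst hk; simp [reaction]
  · simp [reaction, hk]

theorem reaction_id (i : Fin 2) : reaction i (fun μ => μ) = fun _ μ => μ := by
  simp [reaction]

theorem deviation_apply {Ω : Type*} (i : Fin 2) (D : Strategy Ω) (t r : ℕ) (ω : Ω) :
    (fun k => deviation i D k t r ω) = reaction i (D t r ω) := by
  funext k
  by_cases hk : k = i
  · subst hk; simp [reaction, deviation]
  · simp only [reaction, deviation, Function.update_of_ne hk]; rfl

theorem deviation_obey {Ω : Type*} (i : Fin 2) : deviation i (obey : Strategy Ω) = equilibrium := by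
  exact Function.update_eq_self i (fun _ => obey)

theorem toggle_pass (ζ : Profile) : toggle ζ pass = ζ := by
  funext i; simp [toggle, pass]

theorem roundStep_of_closed {t : ℕ} {d : Fin 2 → Bool → Bool} {S : Position} {y : ℝ}
    (hS : S.isOpen = false) : A.roundStep t d S y = S := by
  have h := toggle_pass S.reg
  unfold pass at h
  cases S
  simp only at hS h
  subst hS
  simp [roundStep, h]

/-- This ties the play to the one-shot games. If nobody switches, the stage closes, the potential
becomes the holding value, and `K_self` makes the cost vanish; otherwise the stage stays open with
reduced budgets. -/
theorem potential_roundStep_sub_cost {t h : ℕ} {d : Fin 2 → Bool → Bool} {S : Position} {y : ℝ}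
    (hS : S.isOpen = true) (i : Fin 2) :
    A.potential h i (A.roundStep t d S y) - A.cost i S (A.roundStep t d S y) =
      roundValue A.Γ A.β h (A.n - S.used 0) (A.m - S.used 1) S.reg S.p S.x i
        (fun k => d k (draw (A.lottery t S) y k)) := by
  set a : Profile := fun k => d k (draw (A.lottery t S) y k) with ha
  have e : A.roundStep t d S y =
      ⟨S.p, S.x, toggle S.reg a, fun k => S.used k + (a k).toNat, a 0 || a 1⟩ := by
    simp [roundStep, hS, ha]
  rw [e]
  clear_value a
  unfold roundValue
  split_ifs with hp
  · subst hp
    simp [potential, holdValue, cost, toggle_pass, pass, A.M.K_self]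
  · have hop : (a 0 || a 1) = true := by
      rcases profile_cases a with h | h | h | h
      · exact absurd h (by rw [pass_eq] at hp; exact hp)
      all_goals subst h; rfl
    simp only [potential, hop, if_true, cascadeValue, cost, Nat.sub_add_eq]
    congr 1
    unfold Market.switchCost toggle
    cases a i <;> simp [A.M.K_self]

theorem integral_potential_roundStep {t h : ℕ} (i : Fin 2) (d : Bool → Bool) (S : Position) :
    ∫ y in Set.Icc (0 : ℝ) 1, (A.potential h i (A.roundStep t (reaction i d) S y)
      - A.cost i S (A.roundStep t (reaction i d) S y)) =
      if S.isOpen then ∑ a, A.lottery t S a * roundValue A.Γ A.β h (A.n - S.used 0)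
        (A.m - S.used 1) S.reg S.p S.x i (Function.update a i (d (a i)))
      else A.potential h i S := by
  split_ifs with hS
  · simp only [A.potential_roundStep_sub_cost hS, reaction_apply]
    exact integral_draw (device_nonneg _ _ _ _ _ _ _ _) (device_sum _ _ _ _ _ _ _ _)
      (fun a => roundValue A.Γ A.β h (A.n - S.used 0)
        (A.m - S.used 1) S.reg S.p S.x i (Function.update a i (d (a i))))
  · simp only [A.roundStep_of_closed (Bool.eq_false_of_not_eq_true hS), cost, A.M.K_self]
    simp

/-- The supermartingale inequality with the past frozen. A closed stage is absorbing and contributes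
equality. -/
theorem integral_potential_roundStep_le {t h : ℕ} (ht : t + (h + 1) = A.M.T) {i : Fin 2}
    {d : Bool → Bool} {S : Position} (hd : A.budget i ≤ S.used i → d false = false) :
    ∫ y in Set.Icc (0 : ℝ) 1, (A.potential h i (A.roundStep t (reaction i d) S y)
      - A.cost i S (A.roundStep t (reaction i d) S y)) ≤ A.potential h i S := by
  rw [integral_potential_roundStep]
  split_ifs with hS
  · rw [potential, if_pos hS]
    refine sum_device_mul_roundValue_update_le A.Γ A.β ht _ _ _ _ _ _ fun h0 => hd ?_
    fin_cases i
    · exact Nat.sub_eq_zero_iff_le.1 h0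
    · exact Nat.sub_eq_zero_iff_le.1 h0
  · exact le_rfl

theorem integral_potential_roundStep_obey {t h : ℕ} (ht : t + (h + 1) = A.M.T) (i : Fin 2)
    (S : Position) :
    ∫ y in Set.Icc (0 : ℝ) 1, (A.potential h i (A.roundStep t (reaction i fun μ => μ) S y)
      - A.cost i S (A.roundStep t (reaction i fun μ => μ) S y)) = A.potential h i S := by
  rw [integral_potential_roundStep]
  split_ifs with hS
  · rw [potential, if_pos hS]
    simp only [Function.update_eq_self]
    exact sum_device_mul_roundValue A.Γ A.β ht _ _ _ _ _ _
  · rfl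

/-! ### Pathwise properties of the play -/

variable {Ω : Type*} [mΩ : MeasurableSpace Ω] {Pr : Measure Ω} {E : Environment Pr}
  {D : Fin 2 → Strategy Ω}

theorem used_position_mono (ω : Ω) (q : ℕ) (k : Fin 2) :
    Monotone (fun r => (A.position E D ω q r).used k) :=
  monotone_nat_of_le_succ fun r => by rw [position_succ]; exact Nat.le_add_right _ _

theorem used_start_mono (ω : Ω) (k : Fin 2) : Monotone (fun q => (A.start E D ω q).used k) :=
  monotone_nat_of_le_succ fun q => A.used_position_mono ω q k (Nat.zero_le (A.n + A.m))

theorem used_position_le (ω : Ω) {q r H : ℕ} (hq : q < H) (hr : r ≤ A.n + A.m) (k : Fin 2) :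
    (A.position E D ω q r).used k ≤ (A.start E D ω H).used k :=
  (A.used_position_mono ω q k hr).trans (A.used_start_mono ω k hq)

/-- A stage stays open only if somebody switched in each previous round, so every such round adds at
least one to the total count. -/
theorem le_used_of_isOpen (ω : Ω) (q r : ℕ) (h : (A.position E D ω q r).isOpen = true) :
    r ≤ (A.position E D ω q r).used 0 + (A.position E D ω q r).used 1 := by
  induction r with
  | zero => exact Nat.zero_le _
  | succ r ih =>
    rw [position_succ] at h ⊢
    generalize A.position E D ω q r = S at h ih ⊢
    simp only [roundStep] at h ⊢
    cases hS : S.isOpen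
    · simp [hS] at h
    · have := ih hS
      simp only [hS, Bool.true_and, Bool.or_eq_true] at h ⊢
      rcases h with h | h <;> simp only [h, Bool.toNat_true] <;> omega

/-- Counts grow by at most one per round, and once the budget is reached the device gives weight
zero to every profile in which `j` switches. -/
theorem used_obey_le_budget {j : Fin 2} (hj : D j = obey) {ω : Ω}
    (hη : ∀ t r, 0 ≤ E.η t r ω) (q r : ℕ) : (A.position E D ω q r).used j ≤ A.budget j := by
  have hround : ∀ q, (A.start E D ω q).used j ≤ A.budget j →
      ∀ r, (A.position E D ω q r).used j ≤ A.budget j := by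
    intro q hq r
    induction r with
    | zero => exact hq
    | succ r ih =>
      rw [position_succ]
      generalize A.position E D ω q r = S at ih
      rcases ih.lt_or_eq with h | h
      · simp only [roundStep]
        have := Bool.toNat_le (S.isOpen && D j (A.s + q) r ω
          (draw (A.lottery (A.s + q) S) (E.η (A.s + q) r ω) j))
        omega
      · have h0 : (![A.n - S.used 0, A.m - S.used 1] : Fin 2 → ℕ) j = 0 := by
          fin_cases j
          · exact Nat.sub_eq_zero_iff_le.2 h.ge
          · exact Nat.sub_eq_zero_iff_le.2 h.ge
        have hμ : draw (A.lottery (A.s + q) S) (E.η (A.s + q) r ω) j = false :=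
          draw_apply_eq_false (fun a ha => device_eq_zero_of_budget _ _ _ _ _ _ _ h0 ha)
            (hη _ _)
        simp only [roundStep, hj, hμ, obey]
        simpa using ih
  have hstart : ∀ q, (A.start E D ω q).used j ≤ A.budget j := by
    intro q
    induction q with
    | zero => exact Nat.zero_le _
    | succ q ih => exact hround q ih (A.n + A.m)
  exact hround q (hstart q) r

theorem ae_η_nonneg (E : Environment Pr) : ∀ᵐ ω ∂Pr, ∀ t r, 0 ≤ E.η t r ω := by
  rw [ae_all_iff]; intro t
  rw [ae_all_iff]; intro r
  have h : ∀ᵐ y ∂(Pr.map (E.η t r)), (0 : ℝ) ≤ y := by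
    rw [E.law_η t r]
    filter_upwards [ae_restrict_mem measurableSet_Icc] with y hy using hy.1
  exact ae_of_ae_map (measurable_η' E t r).aemeasurable h

theorem isAdmissible_obey (E : Environment Pr) (i : Fin 2) : A.IsAdmissible E i obey := by
  refine ⟨fun t r μ => measurable_const, ?_⟩
  filter_upwards [ae_η_nonneg E] with ω hω
  exact A.used_obey_le_budget (by simp [deviation]) hω (A.M.T - A.s) 0

theorem IsAdmissible.isAdapted {i : Fin 2} {D : Strategy Ω} (hD : A.IsAdmissible E i D)
    (k : Fin 2) : (deviation i D k).IsAdapted E := by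
  by_cases hk : k = i
  · subst hk; simpa [deviation] using hD.1
  · simp only [deviation, Function.update_of_ne hk]
    exact fun t r μ => measurable_const

theorem IsAdmissible.ae_used_le {i : Fin 2} {D : Strategy Ω} (hD : A.IsAdmissible E i D) :
    ∀ᵐ ω ∂Pr, ∀ q < A.M.T - A.s, ∀ r ≤ A.n + A.m, ∀ k,
      (A.position E (deviation i D) ω q r).used k ≤ A.budget k := by
  filter_upwards [hD.2, ae_η_nonneg E] with ω h1 h2 q hq r hr k
  by_cases hk : k = i
  · subst hk
    exact (A.used_position_le ω hq hr k).trans h1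
  · exact A.used_obey_le_budget (by simp [deviation, hk]) h2 q r

/-- This is why `n + m` rounds suffice. If the stage is still open after them, at least `n + m`
switches have been made within the budgets, so both are exhausted, and the cascade value without
switches is by definition the holding value. -/
theorem potential_last {ω : Ω} {q : ℕ}
    (h : ∀ k, (A.position E D ω q (A.n + A.m)).used k ≤ A.budget k) (l : ℕ) (i : Fin 2) :
    A.potential l i (A.position E D ω q (A.n + A.m)) =
      A.holdValue l i (A.position E D ω q (A.n + A.m)) := by
  have hop := A.le_used_of_isOpen (E := E) (D := D) ω q (A.n + A.m)
  generalize A.position E D ω q (A.n + A.m) = S at h hop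
  unfold potential
  split_ifs with hS
  · have h0 : S.used 0 ≤ A.n := h 0
    have h1 : S.used 1 ≤ A.m := h 1
    have := hop hS
    have e0 : A.n - S.used 0 = 0 := by omega
    have e1 : A.m - S.used 1 = 0 := by omega
    simp only [cascadeValue, holdValue, e0, e1, gameValue]
  · rfl

/-! ### Expectations -/

section Expectation

variable [IsProbabilityMeasure Pr] (hx : 0 < A.x) (hD : ∀ i, (D i).IsAdapted E)

theorem measurable_cascadeValue (h : ℕ) (i : Fin 2) : Measurable (A.cascadeValue h i) := by
  have := measurable_apply_of_countable
    (f := fun (k : (Fin 2 → ℕ) × Profile) (y : ℝ × ℝ) =>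
      gameValue A.M A.Γ A.β h (A.n - k.1 0) (A.m - k.1 1) k.2 y.1 y.2 i)
    (fun k => (tame_gameValue A.Γ A.β _ _ _ _ _).1)
    (Position.measurable_used.prodMk Position.measurable_reg)
    (Position.measurable_p.prodMk Position.measurable_x)
  exact this

theorem measurable_holdValue (h : ℕ) (i : Fin 2) : Measurable (A.holdValue h i) := by
  have := measurable_apply_of_countable
    (f := fun (k : (Fin 2 → ℕ) × Profile) (y : ℝ × ℝ) => A.M.hold i k.2 y.1 y.2
      (fun p' x' => gameValue A.M A.Γ A.β h (A.n - k.1 0) (A.m - k.1 1) k.2 p' x' i))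
    (fun k => ((tame_gameValue A.Γ A.β _ _ _ _ _).hold _ _).1)
    (Position.measurable_used.prodMk Position.measurable_reg)
    (Position.measurable_p.prodMk Position.measurable_x)
  exact this

theorem measurable_potential (h : ℕ) (i : Fin 2) : Measurable (A.potential h i) := by
  unfold potential
  exact Measurable.ite (Position.measurable_isOpen (measurableSet_singleton true))
    (A.measurable_cascadeValue _ _) (A.measurable_holdValue _ _)

theorem measurable_prodMk_reaction {α : Type*} {mα : MeasurableSpace α} {S : α → Position}
    {d : α → Bool → Bool} (hS : Measurable S) (hd : ∀ μ, Measurable fun a => d a μ) :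
    Measurable (fun a => (S a, d a)) :=
  hS.prodMk (measurable_pi_iff.2 hd)

theorem measurable_cost_comp {α : Type*} [MeasurableSpace α] (i : Fin 2) {S S' : α → Position}
    (hS : Measurable S) (hS' : Measurable S') : Measurable (fun a => A.cost i (S a) (S' a)) :=
  (measurable_of_countable (fun z : Profile × Profile => A.M.K i (z.1 i) (z.2 i))).comp
    ((Position.measurable_reg.comp hS).prodMk (Position.measurable_reg.comp hS'))

include hx hD

theorem integrable_remaining_apply (q r : ℕ) {f : ℕ → ℕ → Profile → ℝ → ℝ → ℝ}
    (hf : ∀ n m ζ, A.M.Tame (f n m ζ)) :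
    Integrable (fun ω => f (A.n - (A.position E D ω q r).used 0)
      (A.m - (A.position E D ω q r).used 1) (A.position E D ω q r).reg
      (A.position E D ω q r).p (A.position E D ω q r).x) Pr := by
  have hm := A.measurable_position_ambient hD q r
  simp only [position_p, position_x]
  -- Truncated subtraction keeps the remaining numbers in a finite range even on the null set where
  -- a budget is overspent.
  refine A.integrable_tame_apply hx hD q (f := fun k : ℕ × ℕ × Profile => f k.1 k.2.1 k.2.2)
    (fun k => hf _ _ _) (Finset.range (A.n + 1) ×ˢ Finset.range (A.m + 1) ×ˢ Finset.univ)
    (g := fun ω => (A.n - (A.position E D ω q r).used 0,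
      A.m - (A.position E D ω q r).used 1, (A.position E D ω q r).reg)) ?_ fun ω => ?_
  · have hu := Position.measurable_used.comp hm
    exact ((measurable_of_countable (fun u : Fin 2 → ℕ => A.n - u 0)).comp hu).prodMk
      (((measurable_of_countable (fun u : Fin 2 → ℕ => A.m - u 1)).comp hu).prodMk
        (Position.measurable_reg.comp hm))
  · simp only [Finset.mem_product, Finset.mem_range, Finset.mem_univ, and_true]
    omega

theorem integrable_cascadeValue (h : ℕ) (i : Fin 2) (q r : ℕ) :
    Integrable (fun ω => A.cascadeValue h i (A.position E D ω q r)) Pr :=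
  A.integrable_remaining_apply hx hD q r (f := fun n m ζ p x => gameValue A.M A.Γ A.β h n m ζ p x i)
    fun n m ζ => tame_gameValue A.Γ A.β h n m ζ i

theorem integrable_holdValue (h : ℕ) (i : Fin 2) (q r : ℕ) :
    Integrable (fun ω => A.holdValue h i (A.position E D ω q r)) Pr :=
  A.integrable_remaining_apply hx hD q r (f := fun n m ζ p x => A.M.hold i ζ p x
    (fun p' x' => gameValue A.M A.Γ A.β h n m ζ p' x' i))
    fun n m ζ => (tame_gameValue A.Γ A.β h n m ζ i).hold i ζ

theorem integrable_potential (h : ℕ) (i : Fin 2) (q r : ℕ) :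
    Integrable (fun ω => A.potential h i (A.position E D ω q r)) Pr := by
  refine ((A.integrable_cascadeValue hx hD (h + 1) i q r).abs.add
    (A.integrable_holdValue hx hD h i q r).abs).mono'
    ((A.measurable_potential h i).comp (A.measurable_position_ambient hD q r)).aestronglyMeasurable
    (Filter.Eventually.of_forall fun ω => ?_)
  simp only [Real.norm_eq_abs, Pi.add_apply]
  unfold potential
  split_ifs
  · linarith [abs_nonneg (A.holdValue h i (A.position E D ω q r))]
  · linarith [abs_nonneg (A.cascadeValue (h + 1) i (A.position E D ω q r))]

theorem integrable_profit (i : Fin 2) (q r : ℕ) :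
    Integrable (fun ω => A.M.profit i (A.start E D ω q).p (A.start E D ω q).x
      * level ((A.position E D ω q r).reg i) * A.M.dt) Pr := by
  refine A.integrable_tame_apply hx hD q
    (f := fun (ζ : Profile) p x => A.M.profit i p x * level (ζ i) * A.M.dt) (fun ζ => ?_)
    Finset.univ (g := fun ω => (A.position E D ω q r).reg)
    (Position.measurable_reg.comp (A.measurable_position_ambient hD q r))
    (fun _ => Finset.mem_univ _)
  convert (Market.tame_profit (M := A.M) i).const_mul (level (ζ i) * A.M.dt) using 3
  ring

theorem integrable_cost (i : Fin 2) (q r r' : ℕ) :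
    Integrable (fun ω => A.cost i (A.position E D ω q r) (A.position E D ω q r')) Pr :=
  A.integrable_tame_apply hx hD q
    (f := fun (ζ : Profile × Profile) _ _ => A.M.K i (ζ.1 i) (ζ.2 i))
    (fun _ => Market.tame_const _) Finset.univ
    (g := fun ω => ((A.position E D ω q r).reg, (A.position E D ω q r').reg))
    ((Position.measurable_reg.comp (A.measurable_position_ambient hD q r)).prodMk
      (Position.measurable_reg.comp (A.measurable_position_ambient hD q r')))
    (fun _ => Finset.mem_univ _)

theorem integrable_payoff (i : Fin 2) : Integrable (A.payoff E D i) Pr :=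
  integrable_finsetSum _ fun q _ => (A.integrable_profit hx hD i q (A.n + A.m)).sub
    (integrable_finsetSum _ fun r _ => A.integrable_cost hx hD i q r (r + 1))

theorem integrable_netPayoff (i : Fin 2) : Integrable (A.netPayoff E D i) Pr :=
  integrable_finsetSum _ fun q _ => (A.integrable_profit hx hD i q (A.n + A.m)).sub
    (A.integrable_cost hx hD i q 0 (A.n + A.m))

/-- The expected value after a round, computed by integrating over the draw of the signals. -/
theorem integral_potential_succ (h : ℕ) (i : Fin 2) (q r : ℕ) {d : Ω → Bool → Bool}
    (hd : ∀ μ, Measurable[E.𝓖 (toLex (A.s + q, r))] fun ω => d ω μ)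
    (hae : ∀ᵐ ω ∂Pr, A.position E D ω q (r + 1) =
      A.roundStep (A.s + q) (reaction i (d ω)) (A.position E D ω q r) (E.η (A.s + q) r ω)) :
    Integrable (fun ω => ∫ y in Set.Icc (0 : ℝ) 1,
        (A.potential h i (A.roundStep (A.s + q) (reaction i (d ω)) (A.position E D ω q r) y)
          - A.cost i (A.position E D ω q r)
            (A.roundStep (A.s + q) (reaction i (d ω)) (A.position E D ω q r) y))) Pr ∧
    ∫ ω, (A.potential h i (A.position E D ω q (r + 1))
        - A.cost i (A.position E D ω q r) (A.position E D ω q (r + 1))) ∂Pr =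
      ∫ ω, (∫ y in Set.Icc (0 : ℝ) 1,
        (A.potential h i (A.roundStep (A.s + q) (reaction i (d ω)) (A.position E D ω q r) y)
          - A.cost i (A.position E D ω q r)
            (A.roundStep (A.s + q) (reaction i (d ω)) (A.position E D ω q r) y))) ∂Pr := by
  have hfun : (fun ω => A.potential h i (A.position E D ω q (r + 1))
        - A.cost i (A.position E D ω q r) (A.position E D ω q (r + 1))) =ᵐ[Pr] fun ω =>
      A.potential h i (A.roundStep (A.s + q) (reaction i (d ω)) (A.position E D ω q r)
          (E.η (A.s + q) r ω))
        - A.cost i (A.position E D ω q r) (A.roundStep (A.s + q) (reaction i (d ω))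
            (A.position E D ω q r) (E.η (A.s + q) r ω)) := by
    filter_upwards [hae] with ω hω
    rw [hω]
  have hint := ((A.integrable_potential hx hD h i q (r + 1)).sub
    (A.integrable_cost hx hD i q r (r + 1))).congr hfun
  have hS : Measurable (fun z : (Position × (Bool → Bool)) × ℝ => z.1.1) := by fun_prop
  have hstep : Measurable (fun z : (Position × (Bool → Bool)) × ℝ =>
      A.roundStep (A.s + q) (reaction i z.1.2) z.1.1 z.2) := by
    refine A.measurable_roundStep_comp _ (fun k μ => ?_) hS measurable_snd
    exact (measurable_of_countable (fun e : Bool → Bool => reaction i e k μ)).comp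
      measurable_fst.snd
  have hF : Measurable (fun z : (Position × (Bool → Bool)) × ℝ =>
      A.potential h i (A.roundStep (A.s + q) (reaction i z.1.2) z.1.1 z.2)
        - A.cost i z.1.1 (A.roundStep (A.s + q) (reaction i z.1.2) z.1.1 z.2)) :=
    ((A.measurable_potential h i).comp hstep).sub (A.measurable_cost_comp i hS hstep)
  have hU : Measurable[E.𝓖 (toLex (A.s + q, r))] fun ω => (A.position E D ω q r, d ω) :=
    measurable_prodMk_reaction (A.measurable_position_adapted hD q r) hd
  rw [integral_congr_ae hfun, ← E.law_η (A.s + q) r]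
  exact integral_comp_of_indep (E.𝓖.le _) hU (measurable_η' E (A.s + q) r)
    (E.indep_η (A.s + q) r)
    (F := fun (u : Position × (Bool → Bool)) (y : ℝ) =>
      A.potential h i (A.roundStep (A.s + q) (reaction i u.2) u.1 y)
        - A.cost i u.1 (A.roundStep (A.s + q) (reaction i u.2) u.1 y)) hF hint

/-- The innovation of the stage is independent of everything up to its last round, and integrating
it out turns the next value into the integral inside `hold`. -/
theorem integral_cascadeValue_succ (h : ℕ) (i : Fin 2) (q : ℕ) :
    ∫ ω, A.M.profit i (A.start E D ω q).p (A.start E D ω q).x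
        * level ((A.position E D ω q (A.n + A.m)).reg i) * A.M.dt ∂Pr
      + ∫ ω, A.cascadeValue h i (A.start E D ω (q + 1)) ∂Pr =
      ∫ ω, A.holdValue h i (A.position E D ω q (A.n + A.m)) ∂Pr := by
  have hint := A.integrable_cascadeValue hx hD h i (q + 1) 0
  have hint' : Integrable (fun ω => A.cascadeValue h i
      (A.stageStep (A.position E D ω q (A.n + A.m)) (E.ε (A.s + q) ω))) Pr := hint
  have hF : Measurable (fun z : Position × (ℝ × ℝ) =>
      A.cascadeValue h i (A.stageStep z.1 z.2)) :=
    (A.measurable_cascadeValue h i).comp A.measurable_stageStep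
  have h1 := integral_comp_of_indep (E.𝓖.le _)
    (A.measurable_position_adapted hD q (A.n + A.m)) (measurable_ε' E (A.s + q))
    (E.indep_ε (A.s + q) (A.n + A.m))
    (F := fun S e => A.cascadeValue h i (A.stageStep S e)) hF hint'
  rw [E.law_ε] at h1
  have h2 : ∀ ω, A.holdValue h i (A.position E D ω q (A.n + A.m)) =
      A.M.profit i (A.start E D ω q).p (A.start E D ω q).x
        * level ((A.position E D ω q (A.n + A.m)).reg i) * A.M.dt
      + ∫ e, A.cascadeValue h i (A.stageStep (A.position E D ω q (A.n + A.m)) e) ∂noiseLaw := by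
    intro ω
    rw [← A.position_p ω q (A.n + A.m), ← A.position_x ω q (A.n + A.m)]
    rfl
  have hp := A.integrable_profit hx hD i q (A.n + A.m)
  simp only [start_succ]
  rw [h1.2, ← integral_add hp h1.1]
  exact integral_congr_ae (Filter.Eventually.of_forall fun ω => (h2 ω).symm)

/-- The expected payoff is the value of the cascade plus the expected changes of the value in the
rounds of the play. -/
theorem integral_payoff (i : Fin 2)
    (hb : ∀ᵐ ω ∂Pr, ∀ q < A.M.T - A.s, ∀ r ≤ A.n + A.m, ∀ k,
      (A.position E D ω q r).used k ≤ A.budget k) :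
    ∫ ω, A.payoff E D i ω ∂Pr = gameValue A.M A.Γ A.β (A.M.T - A.s) A.n A.m A.ζ A.p A.x i
      + ∑ q ∈ Finset.range (A.M.T - A.s), ∑ r ∈ Finset.range (A.n + A.m),
        (∫ ω, (A.potential (A.M.T - A.s - (q + 1)) i (A.position E D ω q (r + 1))
            - A.cost i (A.position E D ω q r) (A.position E D ω q (r + 1))) ∂Pr
          - ∫ ω, A.potential (A.M.T - A.s - (q + 1)) i (A.position E D ω q r) ∂Pr) := by
  set H := A.M.T - A.s with hH
  -- The expected value at the start of each stage telescopes from the initial value to `0` at the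
  -- horizon.
  set v : ℕ → ℝ := fun q => ∫ ω, A.cascadeValue (H - q) i (A.start E D ω q) ∂Pr with hv
  have v0 : v 0 = gameValue A.M A.Γ A.β H A.n A.m A.ζ A.p A.x i := by
    simp [hv, cascadeValue, start]
  have vH : v H = 0 := by
    simp [hv, cascadeValue, gameValue]
  have hstage : ∀ q ∈ Finset.range H,
      ∫ ω, (A.M.profit i (A.start E D ω q).p (A.start E D ω q).x * level (A.control E D i q ω)
          * A.M.dt - ∑ r ∈ Finset.range (A.n + A.m),
          A.M.K i ((A.position E D ω q r).reg i) ((A.position E D ω q (r + 1)).reg i)) ∂Pr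
      = (v q - v (q + 1)) + ∑ r ∈ Finset.range (A.n + A.m),
        (∫ ω, (A.potential (H - (q + 1)) i (A.position E D ω q (r + 1))
            - A.cost i (A.position E D ω q r) (A.position E D ω q (r + 1))) ∂Pr
          - ∫ ω, A.potential (H - (q + 1)) i (A.position E D ω q r) ∂Pr) := by
    intro q hq
    rw [Finset.mem_range] at hq
    have hp := A.integrable_profit hx hD i q (A.n + A.m)
    have hc := fun r => A.integrable_cost hx hD i q r (r + 1)
    have hP := A.integrable_potential hx hD (H - (q + 1)) i q
    have e1 : ∫ ω, A.holdValue (H - (q + 1)) i (A.position E D ω q (A.n + A.m)) ∂Pr =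
        ∫ ω, A.potential (H - (q + 1)) i (A.position E D ω q (A.n + A.m)) ∂Pr := by
      refine integral_congr_ae ?_
      filter_upwards [hb] with ω hω
      exact (A.potential_last (fun k => hω q hq _ le_rfl k) _ i).symm
    have e2 : v q = ∫ ω, A.potential (H - (q + 1)) i (A.position E D ω q 0) ∂Pr := by
      have hopen : ∀ ω, (A.start E D ω q).isOpen = true := by
        intro ω; cases q <;> rfl
      -- The index of `potential` counts the stages after the present one, hence the shift by one;
      -- every stage begins open, so the cascade value is the branch in force.
      have : H - q = H - (q + 1) + 1 := by omega
      simp only [hv, potential, position_zero, hopen, if_true, this]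
    have e3 := A.integral_cascadeValue_succ hx hD (H - (q + 1)) i q
    have e4 : ∑ r ∈ Finset.range (A.n + A.m),
        (∫ ω, (A.potential (H - (q + 1)) i (A.position E D ω q (r + 1))
            - A.cost i (A.position E D ω q r) (A.position E D ω q (r + 1))) ∂Pr
          - ∫ ω, A.potential (H - (q + 1)) i (A.position E D ω q r) ∂Pr) =
        ∫ ω, A.potential (H - (q + 1)) i (A.position E D ω q (A.n + A.m)) ∂Pr - v q
          - ∑ r ∈ Finset.range (A.n + A.m),
            ∫ ω, A.cost i (A.position E D ω q r) (A.position E D ω q (r + 1)) ∂Pr := by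
      rw [e2, ← Finset.sum_range_sub
        (fun r => ∫ ω, A.potential (H - (q + 1)) i (A.position E D ω q r) ∂Pr),
        ← Finset.sum_sub_distrib]
      refine Finset.sum_congr rfl fun r _ => ?_
      rw [integral_sub (hP (r + 1)) (hc r)]
      ring
    have e5 := integral_sub hp (integrable_finsetSum (Finset.range (A.n + A.m)) fun r _ => hc r)
    rw [integral_finsetSum _ fun r _ => hc r] at e5
    have e6 : v (q + 1) = ∫ ω, A.cascadeValue (H - (q + 1)) i (A.start E D ω (q + 1)) ∂Pr := rfl
    rw [e4, e6]
    refine e5.trans ?_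
    linarith
  have hint : ∀ q ∈ Finset.range H, Integrable (fun ω =>
      A.M.profit i (A.start E D ω q).p (A.start E D ω q).x * level (A.control E D i q ω)
        * A.M.dt - ∑ r ∈ Finset.range (A.n + A.m),
          A.M.K i ((A.position E D ω q r).reg i) ((A.position E D ω q (r + 1)).reg i)) Pr :=
    fun q _ => (A.integrable_profit hx hD i q (A.n + A.m)).sub
      (integrable_finsetSum _ fun r _ => A.integrable_cost hx hD i q r (r + 1))
  unfold payoff
  rw [integral_finsetSum _ hint, Finset.sum_congr rfl hstage, Finset.sum_add_distrib, Finset.sum_range_sub', v0, vH, sub_zero]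

end Expectation

end Setup

namespace Setup

variable (A : Setup) {Ω : Type*} [mΩ : MeasurableSpace Ω] {Pr : Measure Ω} {E : Environment Pr}

/-! ### Optimality of obedience -/

theorem roundStep_congr {t : ℕ} {d d' : Fin 2 → Bool → Bool} {S : Position} {y : ℝ}
    (h : ∀ k, (S.isOpen && d k (draw (A.lottery t S) y k)) =
      (S.isOpen && d' k (draw (A.lottery t S) y k))) :
    A.roundStep t d S y = A.roundStep t d' S y := by
  simp only [roundStep, h]

/-- An unchanged count means that the reaction to the realized signal was void or was not to switch.
-/
theorem roundStep_reaction_of_used_le {t : ℕ} {i : Fin 2} {d : Bool → Bool} {S : Position}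
    {y : ℝ} (h : (A.roundStep t (reaction i d) S y).used i ≤ S.used i) :
    A.roundStep t (reaction i d) S y = A.roundStep t (reaction i fun _ => false) S y := by
  refine A.roundStep_congr fun k => ?_
  by_cases hk : k = i
  · subst hk
    simp only [roundStep, reaction, Function.update_self] at h ⊢
    generalize (S.isOpen && d (draw (A.lottery t S) y k)) = b at h
    cases b
    · simp
    · simp at h
  · simp [reaction, hk]

section Expectation

variable [IsProbabilityMeasure Pr]

theorem integral_payoff_equilibrium (hx : 0 < A.x) (i : Fin 2) :
    ∫ ω, A.payoff E equilibrium i ω ∂Pr =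
      gameValue A.M A.Γ A.β (A.M.T - A.s) A.n A.m A.ζ A.p A.x i := by
  have hadm := A.isAdmissible_obey E i
  have hD := hadm.isAdapted
  have hb := hadm.ae_used_le
  rw [deviation_obey] at hb
  simp only [deviation_obey] at hD
  rw [A.integral_payoff hx hD i hb, add_eq_left]
  refine Finset.sum_eq_zero fun q hq => Finset.sum_eq_zero fun r _ => ?_
  rw [Finset.mem_range] at hq
  rw [sub_eq_zero, (A.integral_potential_succ hx hD _ i q r (d := fun _ μ => μ)
    (fun μ => measurable_const) ?_).2]
  · refine integral_congr_ae (Filter.Eventually.of_forall fun ω => ?_)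
    exact A.integral_potential_roundStep_obey (by omega) i _
  · refine Filter.Eventually.of_forall fun ω => ?_
    rw [position_succ, reaction_id]
    rfl

theorem integral_payoff_deviation_le (hx : 0 < A.x) {i : Fin 2} {D : Strategy Ω}
    (hadm : A.IsAdmissible E i D) :
    ∫ ω, A.payoff E (deviation i D) i ω ∂Pr ≤
      gameValue A.M A.Γ A.β (A.M.T - A.s) A.n A.m A.ζ A.p A.x i := by
  have hD := hadm.isAdapted
  have hb := hadm.ae_used_le
  rw [A.integral_payoff hx hD i hb, add_le_iff_nonpos_right]
  refine Finset.sum_nonpos fun q hq => Finset.sum_nonpos fun r hr => ?_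
  rw [Finset.mem_range] at hq hr
  -- Admissibility restricts only the realized actions, whereas the frozen inequality needs `d false
  -- = false` for every event with an exhausted budget. The strategy is therefore replaced by one
  -- that refuses to switch in that case; the play changes on a null set only, and the test involves
  -- the past alone.
  set d : Ω → Bool → Bool := fun ω μ =>
    if (A.position E (deviation i D) ω q r).used i < A.budget i then D (A.s + q) r ω μ else false
    with hd
  have hdm : ∀ μ, Measurable[E.𝓖 (toLex (A.s + q, r))] fun ω => d ω μ := by
    intro μ
    have hs : MeasurableSet {S : Position | S.used i < A.budget i} :=
      Position.measurable_used (MeasurableSet.of_discrete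
        (s := {u : Fin 2 → ℕ | u i < A.budget i}))
    exact Measurable.ite (A.measurable_position_adapted hD q r hs) (hadm.1 (A.s + q) r μ)
      measurable_const
  have hstep : ∀ᵐ ω ∂Pr, A.position E (deviation i D) ω q (r + 1) =
      A.roundStep (A.s + q) (reaction i (d ω)) (A.position E (deviation i D) ω q r)
        (E.η (A.s + q) r ω) := by
    filter_upwards [hb] with ω hω
    have h1 := hω q hq (r + 1) hr i
    rw [position_succ, deviation_apply] at h1 ⊢
    by_cases hlt : (A.position E (deviation i D) ω q r).used i < A.budget i
    · simp only [hd, hlt, if_true]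
    · simp only [hd, hlt, if_false]
      exact A.roundStep_reaction_of_used_le (h1.trans (not_lt.1 hlt))
  obtain ⟨hint, heq⟩ :=
    A.integral_potential_succ hx hD (A.M.T - A.s - (q + 1)) i q r (d := d) hdm hstep
  rw [sub_nonpos, heq]
  refine integral_mono hint (A.integrable_potential hx hD _ i q r) fun ω => ?_
  refine A.integral_potential_roundStep_le (by omega) fun hle => ?_
  simp only [hd, if_neg (not_lt.2 hle)]

end Expectation

/-! ### Costs of the net changes of regime -/

section Costs

variable {M : Market} (i : Fin 2) {z a : ℕ → Bool} (hz : ∀ r, z (r + 1) = xor (z r) (a r))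

theorem K_le_sum (z : ℕ → Bool) (R : ℕ) :
    M.K i (z 0) (z R) ≤ ∑ r ∈ Finset.range R, M.K i (z r) (z (r + 1)) := by
  induction R with
  | zero => simp [M.K_self]
  | succ R ih =>
    rw [Finset.sum_range_succ]
    exact (M.K_triangle i _ (z R) _).trans (by linarith)

include hz in
theorem sum_K_of_at_most_one {u : ℕ → ℕ} (hu : ∀ r, u (r + 1) = u r + (a r).toNat) (R : ℕ)
    (h : u R ≤ u 0 + 1) :
    ∑ r ∈ Finset.range R, M.K i (z r) (z (r + 1)) = M.K i (z 0) (z R) := by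
  have hmono : Monotone u := monotone_nat_of_le_succ fun r => by rw [hu]; omega
  -- The first claim carries the induction: when the single switch occurs, no cost has been paid and
  -- the regime is still the initial one.
  have key : ∀ R, (u R = u 0 → z R = z 0 ∧ ∑ r ∈ Finset.range R, M.K i (z r) (z (r + 1)) = 0) ∧
      (u R ≤ u 0 + 1 → ∑ r ∈ Finset.range R, M.K i (z r) (z (r + 1)) = M.K i (z 0) (z R)) := by
    intro R
    induction R with
    | zero => simp [M.K_self]
    | succ R ih =>
      have h0 := hmono (Nat.zero_le R)
      rw [Finset.sum_range_succ, hu, hz]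
      cases ha : a R
      · simp only [Bool.toNat_false, add_zero, Bool.xor_false, M.K_self]
        exact ih
      · simp only [Bool.toNat_true]
        refine ⟨fun h => by omega, fun h => ?_⟩
        obtain ⟨h1, h2⟩ := ih.1 (by omega)
        rw [h2, h1, zero_add]
  exact (key R).2 h

theorem payoff_le_netPayoff (D : Fin 2 → Strategy Ω) (i : Fin 2) (ω : Ω) :
    A.payoff E D i ω ≤ A.netPayoff E D i ω :=
  Finset.sum_le_sum fun q _ => sub_le_sub_left
    (K_le_sum i (fun r => (A.position E D ω q r).reg i) (A.n + A.m)) _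

theorem netPayoff_eq_payoff {D : Fin 2 → Strategy Ω} {i : Fin 2} {ω : Ω}
    (h : ∀ q < A.M.T - A.s, (A.start E D ω (q + 1)).used i ≤ (A.start E D ω q).used i + 1) :
    A.netPayoff E D i ω = A.payoff E D i ω := by
  refine Finset.sum_congr rfl fun q hq => ?_
  congr 1
  exact (sum_K_of_at_most_one i (z := fun r => (A.position E D ω q r).reg i)
    (a := fun r => (A.position E D ω q r).isOpen && D i (A.s + q) r ω
      (draw (A.lottery (A.s + q) (A.position E D ω q r)) (E.η (A.s + q) r ω) i))
    (fun _ => rfl) (u := fun r => (A.position E D ω q r).used i) (fun _ => rfl) (A.n + A.m)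
    (h q (Finset.mem_range.1 hq))).symm

end Costs

end Setup

end EmissionGame

/-! ### The equilibrium inequalities under both ways of charging costs -/

theorem mainTheorem2 (A : EmissionGame.Setup) (hs : A.s ≤ A.M.T) (hx : 0 < A.x)
    {Ω : Type*} [MeasurableSpace Ω] (Pr : MeasureTheory.Measure Ω)
    [MeasureTheory.IsProbabilityMeasure Pr] (E : EmissionGame.Environment Pr) (i : Fin 2) :
    A.IsAdmissible E i EmissionGame.obey ∧
    (∀ D : EmissionGame.Strategy Ω, A.IsAdmissible E i D →
      MeasureTheory.Integrable (A.payoff E (EmissionGame.Setup.deviation i D) i) Pr ∧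
      ∫ ω, A.payoff E (EmissionGame.Setup.deviation i D) i ω ∂Pr
        ≤ ∫ ω, A.payoff E EmissionGame.Setup.equilibrium i ω ∂Pr) ∧
    (MeasureTheory.Integrable (A.netPayoff E EmissionGame.Setup.equilibrium i) Pr ∧
      ∀ D : EmissionGame.Strategy Ω, A.IsAdmissible E i D → A.IsOncePerStage E i D →
        MeasureTheory.Integrable (A.netPayoff E (EmissionGame.Setup.deviation i D) i) Pr ∧
        ∫ ω, A.netPayoff E (EmissionGame.Setup.deviation i D) i ω ∂Pr
          ≤ ∫ ω, A.netPayoff E EmissionGame.Setup.equilibrium i ω ∂Pr) := by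
  have hobey := A.isAdmissible_obey E i
  have heq := hobey.isAdapted
  simp only [EmissionGame.Setup.deviation_obey] at heq
  have hle : ∀ D : EmissionGame.Strategy Ω, A.IsAdmissible E i D →
      ∫ ω, A.payoff E (EmissionGame.Setup.deviation i D) i ω ∂Pr
        ≤ ∫ ω, A.payoff E EmissionGame.Setup.equilibrium i ω ∂Pr := fun D hD => by
    rw [A.integral_payoff_equilibrium hx]
    exact A.integral_payoff_deviation_le hx hD
  refine ⟨hobey, fun D hD => ⟨A.integrable_payoff hx hD.isAdapted i, hle D hD⟩,
    A.integrable_netPayoff hx heq i, fun D hD hone =>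
      ⟨A.integrable_netPayoff hx hD.isAdapted i, ?_⟩⟩
  -- Both conventions agree for the deviation, and pathwise the net convention only favours the
  -- equilibrium, where several switches in one stage may occur.
  calc ∫ ω, A.netPayoff E (EmissionGame.Setup.deviation i D) i ω ∂Pr
      = ∫ ω, A.payoff E (EmissionGame.Setup.deviation i D) i ω ∂Pr := by
        refine MeasureTheory.integral_congr_ae ?_
        filter_upwards [hone] with ω hω
        exact A.netPayoff_eq_payoff hω
    _ ≤ ∫ ω, A.payoff E EmissionGame.Setup.equilibrium i ω ∂Pr := hle D hD
    _ ≤ ∫ ω, A.netPayoff E EmissionGame.Setup.equilibrium i ω ∂Pr :=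
        MeasureTheory.integral_mono (A.integrable_payoff hx heq i)
          (A.integrable_netPayoff hx heq i) (A.payoff_le_netPayoff _ i)
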